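/- **Conventions.** A *band* is a set with an associative idempotent operation; in a band write $x\preceq y$ if $x=xyx$, let $\mathcal D$ be the symmetric part of $\preceq$, and write $x\le y$ if $x=xy=yx$. A *skew lattice* $(S,\curlywedge,\curlyvee)$ is a set with two band operations satisfying $(y\curlywedge x)\curlyvee x=x=x\curlywedge(x\curlyvee y)$ and $x\curlyvee(x\curlywedge y)=x=(y\curlyvee x)\curlywedge x$. The relation $\mathcal D$ is the same for both operations, and $S/\mathcal D$ is a lattice, the *lattice reflection* of $S$. A *right distributive skew lattice* is a skew lattice $S$ such that $(S,\curlywedge)$ is right regular ($x\curlywedge y\curlywedge x=y\curlywedge x$) and normal ($z\curlywedge x\curlywedge y\curlywedge z=z\curlywedge y\curlywedge x\curlywedge z$), $S$ is symmetric ($x\curlywedge y=y\curlywedge x$ if and only if $x\curlyvee y=y\curlyvee x$), $S$ has a zero element (a bottom element for the order $\le$ of $(S,\curlywedge)$), and $S/\mathcal D$ is a bounded distributive lattice. It is a *right Boolean skew lattice* (skew Boolean algebra) if moreover $S/\mathcal D$ is a Boolean lattice. A *global element* is one lying over the top of $S/\mathcal D$. Morphisms preserve $\curlywedge$, $\curlyvee$,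 the zero element and global elements; thus they induce homomorphisms of bounded lattices between the lattice reflections. Bounded distributive lattices are regarded as commutative right distributive skew lattices. The *Boolean envelope* of a bounded distributive lattice $L$ is a homomorphism of bounded lattices $L\to L_B$ with $L_B$ Boolean through which every homomorphism of bounded lattices from $L$ to a Boolean lattice factors uniquely. **Proposition.** The full subcategory of right Boolean skew lattices is a reflective subcategory of the category of right distributive skew lattices, i.e. the inclusion functor has a left adjoint $S\mapsto S_B$. Moreover, for every right distributive skew lattice $S$: 1. the unit $S\to S_B$ of the adjunction is injective; 2. the induced homomorphism $S/\mathcal D\to S_B/\mathcal D$ is a Boolean envelope of $S/\mathcal D$, so that $S_B/\mathcal D\cong (S/\mathcal D)_B$; 3. the square $$\begin{array}{ccc}S&\longrightarrow&S_B\\ \downarrow&&\downarrow\\ S/\mathcal D&\longrightarrow&(S/\mathcal D)_B\end{array}$$ whose vertical maps are the quotient maps is a pullback in the category of right distributive skew lattices, and also a pullback of underlying sets. -/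

import Mathlib

open CategoryTheory

universe u

/-! ### Bands -/

/-- A band: an associative idempotent operation `m` on `X`. -/
structure IsBand {X : Type u} (m : X → X → X) : Prop where
  assoc : ∀ x y z, m (m x y) z = m x (m y z)
  idem : ∀ x, m x x = x

/-- The preorder `x ≼ y ↔ x = x y x` of a band. -/
def BandPre {X : Type u} (m : X → X → X) (x y : X) : Prop := x = m (m x y) x

/-- Green's `𝒟`-relation of a band, the symmetric part of `≼`. -/
def GreenD {X : Type u} (m : X → X → X) (x y : X) : Prop := BandPre m x y ∧ BandPre m y x

/-- Normality: `z x y z = z y x z`. -/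
def IsNormalBand {X : Type u} (m : X → X → X) : Prop :=
  ∀ x y z, m (m (m z x) y) z = m (m (m z y) x) z

/-- Right regularity: `x y x = y x`. -/
def IsRightRegularBand {X : Type u} (m : X → X → X) : Prop :=
  ∀ x y, m (m x y) x = m y x

namespace IsBand

variable {X : Type u} {m : X → X → X}

theorem pre_of_factor (h : IsBand m) {x y s t : X} (e : x = m s (m y t)) : BandPre m x y := by
  have h1 : m x (m y t) = x := by
    calc m x (m y t) = m (m s (m y t)) (m y t) := by rw [← e]
      _ = m s (m y t) := by rw [h.assoc, h.idem]
      _ = x := e.symm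
  have h2 : m (m x y) t = x := by rw [h.assoc, h1]
  calc x = m (m x y) t := h2.symm
    _ = m (m (m x y) (m x y)) t := by rw [h.idem]
    _ = m (m x y) (m (m x y) t) := h.assoc _ _ _
    _ = m (m x y) x := by rw [h2]

theorem pre_refl (h : IsBand m) (x : X) : BandPre m x x := by
  unfold BandPre; rw [h.idem, h.idem]

theorem pre_trans (h : IsBand m) {x y z : X} (h1 : BandPre m x y) (h2 : BandPre m y z) :
    BandPre m x z := by
  apply h.pre_of_factor (s := m x y) (t := m y x)
  calc x = m (m x y) x := h1
    _ = m (m x (m (m y z) y)) x := by rw [← h2]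
    _ = m (m x y) (m z (m y x)) := by simp only [h.assoc]

theorem pre_mul_right (h : IsBand m) {x y : X} (h1 : BandPre m x y) (z : X) :
    BandPre m (m x z) (m y z) := by
  have e1 : m x z = m x (m y (m x z)) := by
    conv_lhs => rw [show x = m (m x y) x from h1]
    simp only [h.assoc]
  have e2 : m x z = m (m (m x z) y) (m x z) := h.pre_of_factor e1
  apply h.pre_of_factor (s := m x z) (t := m y (m x z))
  calc m x z = m (m (m x z) y) (m x z) := e2
    _ = m x (m (m z y) (m x z)) := by simp only [h.assoc]
    _ = m x (m (m (m z y) (m z y)) (m x z)) := by rw [h.idem]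
    _ = m (m x z) (m (m y z) (m y (m x z))) := by simp only [h.assoc]

theorem pre_mul_left (h : IsBand m) {x y : X} (h1 : BandPre m x y) (z : X) :
    BandPre m (m z x) (m z y) := by
  have e1 : m z x = m (m z x) (m y x) := by
    conv_lhs => rw [show x = m (m x y) x from h1]
    simp only [h.assoc]
  have e2 : m z x = m (m (m z x) y) (m z x) := h.pre_of_factor e1
  apply h.pre_of_factor (s := m (m z x) y) (t := m z x)
  calc m z x = m (m (m z x) y) (m z x) := e2
    _ = m (m z x) (m (m y z) x) := by simp only [h.assoc]
    _ = m (m z x) (m (m (m y z) (m y z)) x) := by rw [h.idem]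
    _ = m (m (m z x) y) (m (m z y) (m z x)) := by simp only [h.assoc]

theorem greenD_equivalence (h : IsBand m) : Equivalence (GreenD m) where
  refl x := ⟨h.pre_refl x, h.pre_refl x⟩
  symm := fun h1 => ⟨h1.2, h1.1⟩
  trans := fun h1 h2 => ⟨h.pre_trans h1.1 h2.1, h.pre_trans h2.2 h1.2⟩

theorem greenD_congr (h : IsBand m) {x x' y y' : X} (h1 : GreenD m x x') (h2 : GreenD m y y') :
    GreenD m (m x y) (m x' y') :=
  ⟨h.pre_trans (h.pre_mul_right h1.1 y) (h.pre_mul_left h2.1 x'),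
    h.pre_trans (h.pre_mul_right h1.2 y') (h.pre_mul_left h2.2 x)⟩

theorem greenD_comm (h : IsBand m) (x y : X) : GreenD m (m x y) (m y x) := by
  have key : ∀ a b : X, BandPre m (m a b) (m b a) := fun a b => by
    apply h.pre_of_factor (s := a) (t := b)
    calc m a b = m (m a b) (m a b) := (h.idem _).symm
      _ = m a (m (m b a) b) := by simp only [h.assoc]
  exact ⟨key x y, key y x⟩

end IsBand

/-! ### Skew lattices -/

/-- A skew lattice: two band operations related by the four absorption laws. -/
class SkewLattice (S : Type u) where
  meet : S → S → S
  join : S → S → S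
  meet_band : IsBand meet
  join_band : IsBand join
  join_absorb_left : ∀ x y, join (meet y x) x = x
  meet_absorb_right : ∀ x y, meet x (join x y) = x
  join_absorb_right : ∀ x y, join x (meet x y) = x
  meet_absorb_left : ∀ x y, meet (join y x) x = x

infixl:70 " ⋏ " => SkewLattice.meet
infixl:65 " ⋎ " => SkewLattice.join

/-- The opposite skew lattice, with meet and join interchanged (used only for duality). -/
@[reducible] def SkewLattice.dual {S : Type u} (i : SkewLattice S) : SkewLattice S where
  meet := i.join
  join := i.meet
  meet_band := i.join_band
  join_band := i.meet_band
  join_absorb_left := i.meet_absorb_left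
  meet_absorb_right := i.join_absorb_right
  join_absorb_right := i.meet_absorb_right
  meet_absorb_left := i.join_absorb_left

theorem SkewLattice.greenD_join_of_meet {S : Type u} (i : SkewLattice S) {x y : S}
    (h : GreenD i.meet x y) : GreenD i.join x y := by
  have hm := i.meet_band
  have hj := i.join_band
  -- `x` and `y` are linked through `a = x ⋏ y`
  have hx : i.meet (i.meet x y) x = x := h.1.symm
  have hy : i.meet y (i.meet x y) = y := by rw [← hm.assoc]; exact h.2.symm
  have j1 : i.join (i.meet x y) x = i.meet x y := by
    conv_lhs => rw [← hx]
    rw [hx]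
    have := i.join_absorb_right (i.meet x y) x
    rwa [hx] at this
  have j2 : i.join x (i.meet x y) = x := i.join_absorb_right x y
  have j3 : i.join (i.meet x y) y = y := i.join_absorb_left y x
  have j4 : i.join y (i.meet x y) = i.meet x y := by
    have := i.join_absorb_left (i.meet x y) y
    rwa [hy] at this
  have d1 : GreenD i.join x (i.meet x y) := by
    constructor
    · unfold BandPre; rw [j2, hj.idem]
    · unfold BandPre; rw [j1, hj.idem]
  have d2 : GreenD i.join (i.meet x y) y := by
    constructor
    · unfold BandPre; rw [j3, j4]
    · unfold BandPre; rw [j4, j3]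
  exact hj.greenD_equivalence.trans d1 d2

theorem SkewLattice.greenD_join_iff {S : Type u} [i : SkewLattice S] {x y : S} :
    GreenD i.join x y ↔ GreenD i.meet x y :=
  ⟨fun h => i.dual.greenD_join_of_meet h, fun h => i.greenD_join_of_meet h⟩

/-- Green's `𝒟`-relation of `(S, ⋏)` as a setoid. It is also that of `(S, ⋎)`, by
`SkewLattice.greenD_join_iff`. -/
@[reducible] def greenSetoid (S : Type u) [i : SkewLattice S] : Setoid S :=
  ⟨GreenD i.meet, i.meet_band.greenD_equivalence⟩

/-- The lattice reflection `S/𝒟` of a skew lattice. -/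
def LatRefl (S : Type u) [SkewLattice S] : Type u := Quotient (greenSetoid S)

/-- The quotient map `S → S/𝒟`. -/
def LatRefl.mk {S : Type u} [SkewLattice S] (x : S) : LatRefl S := Quotient.mk (greenSetoid S) x

/-- The lattice structure of `S/𝒟`, induced by `⋏` and `⋎`. -/
instance LatRefl.instLattice (S : Type u) [i : SkewLattice S] : Lattice (LatRefl S) :=
  letI : Max (LatRefl S) := ⟨Quotient.map₂ i.join fun _ _ h1 _ _ h2 =>
    i.greenD_join_iff.1 (i.join_band.greenD_congr (i.greenD_join_iff.2 h1)
      (i.greenD_join_iff.2 h2))⟩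
  letI : Min (LatRefl S) := ⟨Quotient.map₂ i.meet fun _ _ h1 _ _ h2 =>
    i.meet_band.greenD_congr h1 h2⟩
  Lattice.mk'
    (by
      rintro ⟨x⟩ ⟨y⟩
      exact Quotient.sound (i.greenD_join_iff.1 (i.join_band.greenD_comm x y)))
    (by
      rintro ⟨x⟩ ⟨y⟩ ⟨z⟩
      exact congrArg LatRefl.mk (i.join_band.assoc x y z))
    (by
      rintro ⟨x⟩ ⟨y⟩
      exact Quotient.sound (i.meet_band.greenD_comm x y))
    (by
      rintro ⟨x⟩ ⟨y⟩ ⟨z⟩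
      exact congrArg LatRefl.mk (i.meet_band.assoc x y z))
    (by
      rintro ⟨x⟩ ⟨y⟩
      exact congrArg LatRefl.mk (i.join_absorb_right x y))
    (by
      rintro ⟨x⟩ ⟨y⟩
      exact congrArg LatRefl.mk (i.meet_absorb_right x y))

namespace LatRefl

variable {S : Type u} [SkewLattice S]

theorem mk_surjective : Function.Surjective (mk : S → LatRefl S) := Quotient.mk_surjective

theorem mk_meet (x y : S) : mk (x ⋏ y) = mk x ⊓ mk y := rfl

theorem mk_join (x y : S) : mk (x ⋎ y) = mk x ⊔ mk y := rfl

theorem mk_eq_iff {x y : S} : mk x = mk y ↔ GreenD SkewLattice.meet x y :=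
  ⟨fun h => Quotient.exact h, fun h => Quotient.sound h⟩

end LatRefl

/-- A zero element: a bottom element for `x ≤ y ↔ x = x ⋏ y = y ⋏ x`. -/
def IsZeroElem {S : Type u} [SkewLattice S] (z : S) : Prop := ∀ x : S, z ⋏ x = z ∧ x ⋏ z = z

/-- A global element: an element over the top of `S/𝒟`. -/
def IsGlobalElem {S : Type u} [SkewLattice S] (g : S) : Prop := IsTop (LatRefl.mk g)

/-- A right (that is, right-handed) distributive skew lattice: `(S, ⋏)` is right regular and
normal, `S` is symmetric and has a zero element, and `S/𝒟` is a bounded distributive lattice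
(the image of the zero element is its bottom). -/
class IsRightDistributive (S : Type u) [SkewLattice S] : Prop where
  rightRegular : IsRightRegularBand (SkewLattice.meet : S → S → S)
  normal : IsNormalBand (SkewLattice.meet : S → S → S)
  symmetric : ∀ x y : S, x ⋏ y = y ⋏ x ↔ x ⋎ y = y ⋎ x
  exists_zero : ∃ z : S, IsZeroElem z
  exists_top : ∃ t : LatRefl S, IsTop t
  distrib : ∀ a b c : LatRefl S, a ⊓ (b ⊔ c) = (a ⊓ b) ⊔ (a ⊓ c)

instance LatRefl.instDistribLattice (S : Type u) [SkewLattice S] [IsRightDistributive S] :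
    DistribLattice (LatRefl S) :=
  DistribLattice.ofInfSupLe fun a b c => (IsRightDistributive.distrib a b c).le

theorem IsZeroElem.isBot_mk {S : Type u} [SkewLattice S] {z : S} (hz : IsZeroElem z) :
    IsBot (LatRefl.mk z) := by
  intro a
  obtain ⟨x, rfl⟩ := LatRefl.mk_surjective a
  rw [← inf_eq_left, ← LatRefl.mk_meet, (hz x).1]

noncomputable instance LatRefl.instBoundedOrder (S : Type u) [SkewLattice S]
    [IsRightDistributive S] : BoundedOrder (LatRefl S) where
  top := (IsRightDistributive.exists_top (S := S)).choose
  le_top := (IsRightDistributive.exists_top (S := S)).choose_spec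
  bot := LatRefl.mk (IsRightDistributive.exists_zero (S := S)).choose
  bot_le := (IsRightDistributive.exists_zero (S := S)).choose_spec.isBot_mk

/-! ### The category of right distributive skew lattices -/

/-- Right distributive skew lattices. -/
structure RightDistSkewLat : Type (u + 1) where
  carrier : Type u
  [skewLattice : SkewLattice carrier]
  [isRightDistributive : IsRightDistributive carrier]

attribute [instance] RightDistSkewLat.skewLattice RightDistSkewLat.isRightDistributive

namespace RightDistSkewLat

instance : CoeSort RightDistSkewLat.{u} (Type u) := ⟨carrier⟩

/-- Morphisms preserve both operations, the zero element and global elements. -/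
@[ext]
structure Hom (S T : RightDistSkewLat.{u}) where
  toFun : S → T
  map_meet : ∀ x y : S, toFun (x ⋏ y) = toFun x ⋏ toFun y
  map_join : ∀ x y : S, toFun (x ⋎ y) = toFun x ⋎ toFun y
  map_zero : ∀ z : S, IsZeroElem z → IsZeroElem (toFun z)
  map_global : ∀ g : S, IsGlobalElem g → IsGlobalElem (toFun g)

instance : Category RightDistSkewLat.{u} where
  Hom := Hom
  id _ := ⟨id, fun _ _ => rfl, fun _ _ => rfl, fun _ h => h, fun _ h => h⟩
  comp f g := ⟨g.toFun ∘ f.toFun,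
    fun x y => by simp only [Function.comp_apply, f.map_meet, g.map_meet],
    fun x y => by simp only [Function.comp_apply, f.map_join, g.map_join],
    fun _ h => g.map_zero _ (f.map_zero _ h),
    fun _ h => g.map_global _ (f.map_global _ h)⟩

/-- The underlying function of a morphism. -/
def fn {S T : RightDistSkewLat.{u}} (f : S ⟶ T) : S → T := Hom.toFun f

theorem fn_injective {S T : RightDistSkewLat.{u}} {f g : S ⟶ T} (h : fn f = fn g) : f = g :=
  Hom.ext h

/-- The map `S/𝒟 → T/𝒟` induced by a morphism `S → T`. -/
def latReflMap {S T : RightDistSkewLat.{u}} (f : S ⟶ T) : LatRefl S → LatRefl T :=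
  Quotient.map (fn f) fun x y h => by
    have hm := Hom.map_meet f
    refine ⟨?_, ?_⟩
    · have := congrArg (fn f) h.1
      simp only [fn, hm] at this
      exact this
    · have := congrArg (fn f) h.2
      simp only [fn, hm] at this
      exact this

theorem latReflMap_mk {S T : RightDistSkewLat.{u}} (f : S ⟶ T) (x : S) :
    latReflMap f (LatRefl.mk x) = LatRefl.mk (fn f x) := rfl

/-- `S/𝒟 → T/𝒟` as a homomorphism of bounded lattices. -/
noncomputable def latReflHom {S T : RightDistSkewLat.{u}} (f : S ⟶ T) :
    BoundedLatticeHom (LatRefl S) (LatRefl T) where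
  toFun := latReflMap f
  map_sup' := by
    rintro ⟨x⟩ ⟨y⟩
    exact congrArg LatRefl.mk (Hom.map_join f x y)
  map_inf' := by
    rintro ⟨x⟩ ⟨y⟩
    exact congrArg LatRefl.mk (Hom.map_meet f x y)
  map_top' := by
    obtain ⟨g, hg⟩ := LatRefl.mk_surjective (⊤ : LatRefl S)
    rw [← hg, latReflMap_mk]
    have h : IsGlobalElem g := by
      unfold IsGlobalElem; rw [hg]; exact isTop_top
    exact (Hom.map_global f g h).eq_top
  map_bot' := by
    have hz := (IsRightDistributive.exists_zero (S := S)).choose_spec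
    exact (Hom.map_zero f _ hz).isBot_mk.eq_bot

/-- The lattice reflection functor `S ↦ S/𝒟`. -/
noncomputable def latticeReflection : RightDistSkewLat.{u} ⥤ BddDistLat.{u} where
  obj S := BddDistLat.of (LatRefl S)
  map f := BddDistLat.ofHom (latReflHom f)
  map_id S := by
    ext a
    obtain ⟨x, rfl⟩ := LatRefl.mk_surjective a
    rfl
  map_comp f g := by
    ext a
    obtain ⟨x, rfl⟩ := LatRefl.mk_surjective a
    rfl

end RightDistSkewLat

/-! ### Bounded distributive lattices as right distributive skew lattices -/

/-- A lattice viewed as a (commutative) skew lattice. -/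
instance SkewLattice.ofLattice (L : Type u) [Lattice L] : SkewLattice L where
  meet x y := x ⊓ y
  join x y := x ⊔ y
  meet_band := ⟨inf_assoc, inf_idem⟩
  join_band := ⟨sup_assoc, sup_idem⟩
  join_absorb_left _ _ := sup_eq_right.2 inf_le_right
  meet_absorb_right _ _ := inf_sup_self
  join_absorb_right _ _ := sup_inf_self
  meet_absorb_left _ _ := inf_eq_right.2 le_sup_right

namespace OfLattice

variable {L : Type u}

theorem isZeroElem_bot [Lattice L] [BoundedOrder L] : IsZeroElem (⊥ : L) :=
  fun x => ⟨bot_inf_eq x, inf_bot_eq x⟩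

theorem isGlobalElem_top [Lattice L] [BoundedOrder L] : IsGlobalElem (⊤ : L) := by
  intro a
  obtain ⟨x, rfl⟩ := LatRefl.mk_surjective a
  rw [← inf_eq_left, ← LatRefl.mk_meet]
  exact congrArg LatRefl.mk (inf_top_eq x)

theorem mk_injective [Lattice L] : Function.Injective (LatRefl.mk : L → LatRefl L) := by
  intro x y h
  have hd := LatRefl.mk_eq_iff.1 h
  have key : ∀ a b : L, BandPre SkewLattice.meet a b → a ≤ b := fun a b hab => by
    have e : a = (a ⊓ b) ⊓ a := hab
    rw [e]
    exact inf_le_left.trans inf_le_right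
  exact le_antisymm (key x y hd.1) (key y x hd.2)

theorem eq_bot [Lattice L] [BoundedOrder L] {z : L} (hz : IsZeroElem z) : z = ⊥ :=
  (hz ⊥).1.symm.trans (inf_bot_eq z)

theorem eq_top [Lattice L] [BoundedOrder L] {g : L} (hg : IsGlobalElem g) : g = ⊤ :=
  mk_injective (le_antisymm (isGlobalElem_top _) (hg _))

end OfLattice

instance IsRightDistributive.ofLattice (L : Type u) [DistribLattice L] [BoundedOrder L] :
    IsRightDistributive L where
  rightRegular x y := show (x ⊓ y) ⊓ x = y ⊓ x by
    rw [inf_comm x y, inf_assoc, inf_idem]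
  normal x y z := show ((z ⊓ x) ⊓ y) ⊓ z = ((z ⊓ y) ⊓ x) ⊓ z by
    rw [inf_right_comm z x y]
  symmetric x y := ⟨fun _ => sup_comm x y, fun _ => inf_comm x y⟩
  exists_zero := ⟨_, OfLattice.isZeroElem_bot⟩
  exists_top := ⟨_, OfLattice.isGlobalElem_top⟩
  distrib := by
    rintro ⟨x⟩ ⟨y⟩ ⟨z⟩
    exact congrArg LatRefl.mk (inf_sup_left x y z)

namespace RightDistSkewLat

/-- The inclusion of bounded distributive lattices into right distributive skew lattices. -/
def ofBddDistLat : BddDistLat.{u} ⥤ RightDistSkewLat.{u} where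
  obj L := { carrier := L }
  map {L M} f :=
    { toFun := fun x : L => f.hom x
      map_meet := fun x y : L => map_inf f.hom x y
      map_join := fun x y : L => map_sup f.hom x y
      map_zero := fun (z : L) hz => by
        rw [OfLattice.eq_bot hz, map_bot]
        exact OfLattice.isZeroElem_bot
      map_global := fun (g : L) hg => by
        rw [OfLattice.eq_top hg, map_top]
        exact OfLattice.isGlobalElem_top }

/-- The quotient maps `S → S/𝒟`, as a natural transformation. -/
noncomputable def toLatticeReflection :
    𝟭 RightDistSkewLat.{u} ⟶ latticeReflection ⋙ ofBddDistLat where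
  app S :=
    { toFun := fun x => LatRefl.mk x
      map_meet := fun _ _ => rfl
      map_join := fun _ _ => rfl
      map_zero := fun z hz => by
        have h : LatRefl.mk z = (⊥ : LatRefl S) := hz.isBot_mk.eq_bot
        exact h ▸ OfLattice.isZeroElem_bot (L := LatRefl S)
      map_global := fun g hg => by
        have h : LatRefl.mk g = (⊤ : LatRefl S) := IsTop.eq_top hg
        exact h ▸ OfLattice.isGlobalElem_top (L := LatRefl S) }

/-- Right Boolean skew lattices: those right distributive skew lattices `S` for which `S/𝒟` is a
Boolean lattice. -/
def isBoolean : ObjectProperty RightDistSkewLat.{u} := fun S => ComplementedLattice (LatRefl S)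

end RightDistSkewLat

/-! ### Boolean envelopes -/

/-- `j : L → B` is a Boolean envelope: `B` is a Boolean lattice, and every homomorphism of bounded
lattices from `L` to a Boolean lattice `C` factors uniquely through `j`. -/
structure IsBooleanEnvelope {L B : BddDistLat.{u}} (j : L ⟶ B) : Prop where
  complemented : ComplementedLattice B
  existsUnique_lift : ∀ (C : BddDistLat.{u}), ComplementedLattice C →
    ∀ g : L ⟶ C, ∃! h : B ⟶ C, j ≫ h = g

/-! ### Strong distributivity of right distributive skew lattices -/

/-! The skew lattice `S` is represented by sections over the prime spectrum of `S/𝒟`. For `a` over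
`u` and `b` over `v`, the element `a ⋎ (b ⋏ x)` is the restriction of `x` to the interval from `u`
to `v`, that is, to the points `p` with `p u = false` and `p v = true`. Strong distributivity
(`join_meet`, `meet_join`) makes restriction compatible with both operations, and cancellation
(`eq_of_meet_eq_of_join_eq`) makes agreement on adjacent intervals glue (`AgreeOn.glue`).

The stalk at a prime `p` identifies elements that agree on some interval around `p`. It has at most
one germ outside the support, and its operations are forced by supports: `a ⋏ b` is `b` if `a` is in
the support and `a` otherwise, and dually for `⋎` (`Stalk.meet_eq_ite`, `Stalk.join_eq_ite`).

The envelope consists of the sections that are locally given by elements of `S`, for the patch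
topology. Supports are clopen there, hence complemented. Compactness, in the form of
`interval_induction`, passes from local to global: `S` embeds, its image consists of the sections
whose support comes from `S/𝒟` (`exists_eq_of`, which is the pullback property), and the embedding
is onto when `S/𝒟` is Boolean (`of_surjective`).

The adjunction is then formal: the construction is functorial, `envMap (toEnv S) = toEnv (env S)`,
and `toEnv T` is invertible for Boolean `T`. Restricting the universal property to commutative
Boolean targets shows that the lattice reflection of the unit is a Boolean envelope. -/

namespace SkewLattice

section Basic

variable {S : Type u} [i : SkewLattice S]

theorem meet_assoc (x y z : S) : x ⋏ y ⋏ z = x ⋏ (y ⋏ z) := i.meet_band.assoc x y z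

theorem join_assoc (x y z : S) : x ⋎ y ⋎ z = x ⋎ (y ⋎ z) := i.join_band.assoc x y z

theorem meet_idem (x : S) : x ⋏ x = x := i.meet_band.idem x

theorem join_idem (x : S) : x ⋎ x = x := i.join_band.idem x

/-- Both operations define the same natural order. -/
theorem meet_eq_left_iff {x y : S} : x ⋏ y = x ↔ x ⋎ y = y :=
  ⟨fun h => by simpa only [h] using join_absorb_left y x,
    fun h => by simpa only [h] using meet_absorb_right x y⟩

/-- `x` and `y` have the same restriction to the interval from `u` to `v`. -/
def AgreeOn (u v : LatRefl S) (x y : S) : Prop :=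
  ∀ a b : S, LatRefl.mk a = u → LatRefl.mk b = v → a ⋎ (b ⋏ x) = a ⋎ (b ⋏ y)

namespace AgreeOn

variable {u v : LatRefl S} {x y z : S}

theorem refl (u v : LatRefl S) (x : S) : AgreeOn u v x x := fun _ _ _ _ => rfl

theorem symm (h : AgreeOn u v x y) : AgreeOn u v y x := fun a b ha hb => (h a b ha hb).symm

theorem trans (h : AgreeOn u v x y) (h' : AgreeOn u v y z) : AgreeOn u v x z :=
  fun a b ha hb => (h a b ha hb).trans (h' a b ha hb)

theorem sup_mk_eq (h : AgreeOn u v x y) :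
    u ⊔ (v ⊓ LatRefl.mk x) = u ⊔ (v ⊓ LatRefl.mk y) := by
  obtain ⟨a, rfl⟩ := LatRefl.mk_surjective u
  obtain ⟨b, rfl⟩ := LatRefl.mk_surjective v
  exact congrArg LatRefl.mk (h a b rfl rfl)

end AgreeOn

end Basic

variable {S : Type u} [SkewLattice S] [IsRightDistributive S]

theorem meet_right_regular (x y : S) : x ⋏ (y ⋏ x) = y ⋏ x := by
  rw [← meet_assoc]; exact IsRightDistributive.rightRegular x y

/-- Normality gives the identity with an extra `z` on the left; right regularity absorbs that `z`.
-/
theorem meet_left_comm (x y z : S) : x ⋏ (y ⋏ z) = y ⋏ (x ⋏ z) := by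
  have h := IsRightDistributive.normal x y z
  have h1 := meet_right_regular z (x ⋏ y)
  have h2 := meet_right_regular z (y ⋏ x)
  simp only [meet_assoc] at h h1 h2
  rw [← h1, ← h2, h]

/-- Right-handedness makes the preorder `≼` one-sided, so inequalities in `S/𝒟` become equations in
`S`. -/
theorem mk_le_iff {x y : S} : LatRefl.mk x ≤ LatRefl.mk y ↔ y ⋏ x = x := by
  constructor
  · intro h
    rw [← inf_eq_left, ← LatRefl.mk_meet, LatRefl.mk_eq_iff] at h
    have h2 : x = x ⋏ (x ⋏ y) ⋏ x := h.2
    rw [meet_assoc, meet_assoc, meet_right_regular, meet_right_regular] at h2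
    exact h2.symm
  · intro h
    rw [← inf_eq_right, ← LatRefl.mk_meet, h]

theorem mk_le_iff_join {x y : S} : LatRefl.mk x ≤ LatRefl.mk y ↔ y ⋎ x = y := by
  constructor
  · intro h
    simpa only [mk_le_iff.1 h] using join_absorb_right y x
  · intro h
    rw [← sup_eq_left, ← LatRefl.mk_join, h]

theorem join_left_regular (x y : S) : x ⋎ (y ⋎ x) = x ⋎ y := by
  rw [← join_assoc]
  exact mk_le_iff_join.1 (by rw [LatRefl.mk_join]; exact le_sup_left)

/-- `x ⋏ z` depends only on `z` and on the `𝒟`-class of `x ⋏ z`. -/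
theorem meet_eq_meet {x y z : S}
    (h : LatRefl.mk x ⊓ LatRefl.mk z = LatRefl.mk y ⊓ LatRefl.mk z) : x ⋏ z = y ⋏ z := by
  have h1 := mk_le_iff.1 (show LatRefl.mk (x ⋏ z) ≤ LatRefl.mk (y ⋏ z) from h.le)
  have h2 := mk_le_iff.1 (show LatRefl.mk (y ⋏ z) ≤ LatRefl.mk (x ⋏ z) from h.ge)
  rw [meet_assoc, meet_right_regular] at h1 h2
  rw [← h1, meet_left_comm, h2]

/-- Both sides have the form `w ⋏ z`, so `meet_eq_meet` reduces the claim to distributivity of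
`S/𝒟`. -/
theorem join_meet (x y z : S) : (x ⋎ y) ⋏ z = (x ⋏ z) ⋎ (y ⋏ z) := by
  have h : ((x ⋏ z) ⋎ (y ⋏ z)) ⋏ z = (x ⋏ z) ⋎ (y ⋏ z) := by
    rw [meet_eq_left_iff, join_assoc, join_absorb_left, join_absorb_left]
  rw [← h]
  apply meet_eq_meet
  simp only [LatRefl.mk_meet, LatRefl.mk_join, ← inf_sup_right, inf_assoc, inf_idem]

/-- By `meet_eq_meet` it suffices that `(z ⋏ x) ⋎ (z ⋏ y)` lies below `x ⋎ y` in the natural order.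
Symmetry gives this: the left element commutes with `x` for `⋏`, hence also for `⋎`. -/
theorem meet_join (z x y : S) : z ⋏ (x ⋎ y) = (z ⋏ x) ⋎ (z ⋏ y) := by
  set x' := z ⋏ x with hx
  set y' := z ⋏ y with hy
  have hx' : LatRefl.mk x' = LatRefl.mk z ⊓ LatRefl.mk x := rfl
  have hy' : LatRefl.mk y' = LatRefl.mk z ⊓ LatRefl.mk y := rfl
  have hxx : x' ⋏ x = x' := by rw [hx, meet_assoc, meet_idem]
  have c1 : x ⋏ (x' ⋎ y') = x' := by
    conv_rhs => rw [← meet_absorb_right x' y']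
    apply meet_eq_meet
    rw [LatRefl.mk_join, hx', hy']
    apply le_antisymm
    · refine le_inf (le_inf (inf_le_right.trans (sup_le inf_le_left inf_le_left)) inf_le_left)
        inf_le_right
    · exact le_inf (inf_le_left.trans inf_le_right) inf_le_right
  have c2 : (x' ⋎ y') ⋏ x = x' := by
    rw [join_meet, hxx, ← mk_le_iff_join]
    simp only [LatRefl.mk_meet, hx', hy']
    exact le_inf (inf_le_left.trans inf_le_left) inf_le_right
  have c3 := (IsRightDistributive.symmetric x (x' ⋎ y')).1 (c1.trans c2.symm)
  have c4 : x ⋎ (x' ⋎ y') = x ⋎ y' := by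
    rw [← join_assoc, mk_le_iff_join.1 (hx'.le.trans inf_le_right)]
  have c5 : (x' ⋎ y') ⋎ (x ⋎ y') = x ⋎ y' := by
    rw [← c4, c3, ← join_assoc, join_idem]
  have c6 : (x ⋎ y') ⋎ (x ⋎ y) = x ⋎ y := by
    have e : y' ⋎ y = y := join_absorb_left y z
    rw [← join_assoc, join_assoc x y' x, join_left_regular, join_assoc, e]
  have c7 : (x' ⋎ y') ⋎ (x ⋎ y) = x ⋎ y := by
    rw [← c6, ← join_assoc, c5]
  rw [← meet_eq_left_iff] at c7
  rw [← c7]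
  apply meet_eq_meet
  simp only [LatRefl.mk_join, hx', hy', ← inf_sup_left, inf_assoc, inf_idem]

/-- Cancellation in the distributive lattice `S/𝒟` shows that the classes agree; then `z` is
recovered from its class, `c ⋏ z` and `c ⋎ z` through the identity `key`, which rests on symmetry.
-/
theorem eq_of_meet_eq_of_join_eq {c x y : S} (hm : c ⋏ x = c ⋏ y) (hj : c ⋎ x = c ⋎ y) :
    x = y := by
  have hc : LatRefl.mk x = LatRefl.mk y :=
    eq_of_inf_eq_sup_eq (a := LatRefl.mk c) 
      (by simpa only [← LatRefl.mk_meet, inf_comm] using congrArg LatRefl.mk hm)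
      (by simpa only [← LatRefl.mk_join, sup_comm] using congrArg LatRefl.mk hj)
  have key : ∀ z : S, z ⋏ ((c ⋏ z) ⋎ (c ⋎ z)) = z := by
    intro z
    have h1 : ((c ⋏ z) ⋎ c) ⋏ z = z ⋏ ((c ⋏ z) ⋎ c) := by
      have h2 : (c ⋏ z) ⋏ ((c ⋏ z) ⋎ c) = c ⋏ z := meet_absorb_right _ _
      rw [join_meet, meet_assoc, meet_idem, join_idem]
      conv_lhs => rw [← h2]
      apply meet_eq_meet
      simp only [LatRefl.mk_meet, LatRefl.mk_join]
      apply le_antisymm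
      · exact inf_le_inf_right _ inf_le_right
      · refine le_inf (le_inf (inf_le_right.trans (sup_le inf_le_left le_rfl)) inf_le_left)
          inf_le_right
    rw [← join_assoc, (IsRightDistributive.symmetric _ _).1 h1, meet_absorb_right]
  rw [← key x, ← key y, hm, hj]
  apply meet_eq_meet
  rw [hc]

/-- The global elements are left units for the meet. -/
theorem meet_of_isGlobalElem {g : S} (hg : IsGlobalElem g) (x : S) : g ⋏ x = x :=
  mk_le_iff.1 (hg _)

theorem isZeroElem_iff {z : S} : IsZeroElem z ↔ LatRefl.mk z = ⊥ := by
  refine ⟨fun h => h.isBot_mk.eq_bot, fun h => ?_⟩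
  obtain ⟨z', hz'⟩ := IsRightDistributive.exists_zero (S := S)
  have h1 := mk_le_iff.1 (h.le.trans bot_le : LatRefl.mk z ≤ LatRefl.mk z')
  rw [(hz' z).1] at h1
  exact h1 ▸ hz'

theorem isGlobalElem_iff {g : S} : IsGlobalElem g ↔ LatRefl.mk g = ⊤ :=
  ⟨fun h => h.eq_top, fun h => by unfold IsGlobalElem; rw [h]; exact isTop_top⟩

/-! ### Calculus of restrictions to intervals -/

namespace AgreeOn

variable {u v u' v' w : LatRefl S} {x y z : S}

/-- A single pair of representatives suffices, even for a smaller interval: the restriction to `[u,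
v]` can be computed from `a ⋎ (b ⋏ z)`. The two inequalities say that every prime with `u` false and
`v` true has `a` false and `b` true. -/
theorem of_exists {a b : S} (h : a ⋎ (b ⋏ x) = a ⋎ (b ⋏ y))
    (hv : v ≤ u ⊔ LatRefl.mk b) (hu : v ⊓ LatRefl.mk a ≤ u) : AgreeOn u v x y := by
  rintro c d rfl rfl
  have key : ∀ z : S, c ⋎ (d ⋏ z) = c ⋎ (d ⋏ (a ⋎ (b ⋏ z))) := by
    intro z
    have h1 : c ⋎ (d ⋏ a) = c := mk_le_iff_join.1 hu
    have h2 : d ⋏ z = (d ⋏ (c ⋎ b)) ⋏ z := by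
      apply meet_eq_meet
      rw [LatRefl.mk_meet, LatRefl.mk_join, inf_eq_left.2 hv]
    have h3 : c ⋎ (d ⋏ c ⋏ z) = c :=
      mk_le_iff_join.1 (inf_le_left.trans inf_le_right :
        LatRefl.mk d ⊓ LatRefl.mk c ⊓ LatRefl.mk z ≤ LatRefl.mk c)
    rw [meet_join, ← join_assoc, h1, h2, meet_join, join_meet, ← join_assoc, h3, meet_assoc]
  rw [key x, key y, h]

theorem mono (h : AgreeOn u v x y) (hv : v' ≤ u' ⊔ v) (hu : v' ⊓ u ≤ u') :
    AgreeOn u' v' x y := by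
  obtain ⟨a, rfl⟩ := LatRefl.mk_surjective u
  obtain ⟨b, rfl⟩ := LatRefl.mk_surjective v
  exact of_exists (h a b rfl rfl) hv hu

theorem of_le (h : v ≤ u) : AgreeOn u v x y := by
  rintro a b rfl rfl
  rw [mk_le_iff_join.1 (inf_le_left.trans h : LatRefl.mk b ⊓ LatRefl.mk x ≤ _),
    mk_le_iff_join.1 (inf_le_left.trans h : LatRefl.mk b ⊓ LatRefl.mk y ≤ _)]

/-- For `c` over `w`, meeting with `c` leaves the restriction to `[u, w]` and joining with `c`
leaves that to `[w, v]`; cancellation does the rest. -/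
theorem glue (h : AgreeOn u w x y) (h' : AgreeOn w v x y) (huw : u ≤ w) (hwv : w ≤ v) :
    AgreeOn u v x y := by
  rintro a b rfl rfl
  obtain ⟨c, rfl⟩ := LatRefl.mk_surjective w
  have h1 : ∀ z : S, c ⋏ (a ⋎ (b ⋏ z)) = a ⋎ (c ⋏ z) := fun z => by
    rw [meet_join, mk_le_iff.1 huw]
    congr 1
    rw [← meet_assoc]
    apply meet_eq_meet
    rw [LatRefl.mk_meet, inf_eq_left.2 hwv]
  have h2 : ∀ z : S, c ⋎ (a ⋎ (b ⋏ z)) = c ⋎ (b ⋏ z) := fun z => by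
    rw [← join_assoc, mk_le_iff_join.1 huw]
  refine eq_of_meet_eq_of_join_eq (c := c) ?_ ?_
  · rw [h1, h1, h a c rfl rfl]
  · rw [h2, h2, h' c b rfl rfl]

theorem eq (h : AgreeOn ⊥ ⊤ x y) : x = y := by
  obtain ⟨a, ha⟩ := LatRefl.mk_surjective (⊥ : LatRefl S)
  obtain ⟨b, hb⟩ := LatRefl.mk_surjective (⊤ : LatRefl S)
  have key : ∀ z : S, a ⋎ (b ⋏ z) = z := fun z => by
    rw [meet_of_isGlobalElem (isGlobalElem_iff.2 hb), ← meet_eq_left_iff]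
    exact (isZeroElem_iff.2 ha z).1
  rw [← key x, ← key y, h a b ha hb]

/-- The restriction of `r ⋏ z` depends on `z` only through the restriction of `z`. This lemma and
its three analogues make the operations descend to stalks. -/
theorem meet_left (h : AgreeOn u v x y) (r : S) : AgreeOn u v (r ⋏ x) (r ⋏ y) := by
  intro a b ha hb
  have key : ∀ z : S, a ⋎ (b ⋏ (r ⋏ z)) = a ⋎ (r ⋏ (a ⋎ (b ⋏ z))) := fun z => by
    rw [meet_join, ← join_assoc, mk_le_iff_join.1 (inf_le_right : LatRefl.mk r ⊓ LatRefl.mk a ≤ _),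
      meet_left_comm]
  rw [key x, key y, h a b ha hb]

theorem meet_right (h : AgreeOn u v x y) (r : S) : AgreeOn u v (x ⋏ r) (y ⋏ r) := by
  intro a b ha hb
  have key : ∀ z : S, a ⋎ (b ⋏ (z ⋏ r)) = a ⋎ ((a ⋎ (b ⋏ z)) ⋏ r) := fun z => by
    rw [join_meet, ← join_assoc, join_absorb_right, meet_assoc]
  rw [key x, key y, h a b ha hb]

theorem join_left (h : AgreeOn u v x y) (r : S) : AgreeOn u v (r ⋎ x) (r ⋎ y) := by
  intro a b ha hb
  have key : ∀ z : S, a ⋎ (b ⋏ (r ⋎ z)) = a ⋎ (b ⋏ r) ⋎ (a ⋎ (b ⋏ z)) := fun z => by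
    rw [meet_join, ← join_assoc, ← join_assoc, join_assoc a _ a, join_left_regular]
  rw [key x, key y, h a b ha hb]

theorem join_right (h : AgreeOn u v x y) (r : S) : AgreeOn u v (x ⋎ r) (y ⋎ r) := by
  intro a b ha hb
  rw [meet_join, meet_join, ← join_assoc, ← join_assoc, h a b ha hb]

end AgreeOn

end SkewLattice

/-! ### The spectrum of a bounded distributive lattice -/

namespace BoundedLatticeHom

section Topology

variable {L : Type u} [Lattice L] [BoundedOrder L]

theorem apply_eq_true_of_le (p : BoundedLatticeHom L Bool) {a b : L} (hab : a ≤ b)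
    (ha : p a = true) : p b = true := by
  rw [← sup_eq_right.2 hab, map_sup, ha]; exact top_sup_eq _

/-- The patch topology on the prime spectrum. -/
noncomputable instance : TopologicalSpace (BoundedLatticeHom L Bool) :=
  .induced DFunLike.coe inferInstance

theorem continuous_coe : Continuous (DFunLike.coe : BoundedLatticeHom L Bool → L → Bool) :=
  continuous_induced_dom

theorem continuous_eval (a : L) : Continuous fun p : BoundedLatticeHom L Bool => p a :=
  (continuous_apply a).comp continuous_coe

theorem isOpen_setOf_apply_eq (a : L) (b : Bool) :
    IsOpen {p : BoundedLatticeHom L Bool | p a = b} :=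
  (isOpen_discrete {b}).preimage (continuous_eval a)

/-- Being a homomorphism is a conjunction of equations, each involving finitely many coordinates.
Compactness of the spectrum follows from that of the product. -/
theorem isClosed_range_coe :
    IsClosed (Set.range (DFunLike.coe : BoundedLatticeHom L Bool → L → Bool)) := by
  have e : Set.range (DFunLike.coe : BoundedLatticeHom L Bool → L → Bool) =
      {f | (∀ a b, f (a ⊔ b) = (f a || f b)) ∧ (∀ a b, f (a ⊓ b) = (f a && f b)) ∧
        f ⊤ = true ∧ f ⊥ = false} := by
    ext f
    constructor
    · rintro ⟨p, rfl⟩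
      exact ⟨fun a b => map_sup p a b, fun a b => map_inf p a b, map_top p, map_bot p⟩
    · rintro ⟨h1, h2, h3, h4⟩
      exact ⟨⟨⟨⟨f, h1⟩, h2⟩, h3, h4⟩, rfl⟩
  rw [e]
  have c : ∀ g : Bool → Bool → Bool, ∀ a b : L,
      Continuous fun f : L → Bool => g (f a) (f b) := fun g a b => by
    have hg : Continuous (Function.uncurry g) := continuous_of_discreteTopology
    have ha : Continuous fun f : L → Bool => (f a, f b) :=
      (continuous_apply a).prodMk (continuous_apply b)
    exact hg.comp ha
  have h1 : ∀ g : Bool → Bool → Bool, ∀ m : L → L → L,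
      IsClosed {f : L → Bool | ∀ a b, f (m a b) = g (f a) (f b)} := fun g m => by
    simp only [Set.ofPred_forall]
    exact isClosed_iInter fun a => isClosed_iInter fun b =>
      isClosed_eq (continuous_apply _) (c g a b)
  exact (h1 _ _).inter ((h1 _ _).inter
    ((isClosed_eq (continuous_apply _) continuous_const).inter
      (isClosed_eq (continuous_apply _) continuous_const)))

instance : CompactSpace (BoundedLatticeHom L Bool) :=
  (Topology.IsClosedEmbedding.mk ⟨⟨rfl⟩, DFunLike.coe_injective⟩ isClosed_range_coe).compactSpace

/-- A basic neighbourhood prescribes finitely many values: the elements sent to `false` are joined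
into `u`, those sent to `true` are met into `v`. -/
theorem exists_interval_of_mem_nhds {p : BoundedLatticeHom L Bool}
    {U : Set (BoundedLatticeHom L Bool)} (hU : U ∈ nhds p) :
    ∃ u v : L, p u = false ∧ p v = true ∧
      ∀ q : BoundedLatticeHom L Bool, q u = false → q v = true → q ∈ U := by
  rw [nhds_induced, nhds_pi, Filter.mem_comap] at hU
  obtain ⟨V, hV, hVU⟩ := hU
  obtain ⟨I, hI, t, ht, htV⟩ := Filter.mem_pi.1 hV
  have key : ∀ J : Set L, J.Finite → ∃ u v : L, p u = false ∧ p v = true ∧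
      ∀ q : BoundedLatticeHom L Bool, q u = false → q v = true → ∀ a ∈ J, q a = p a := by
    intro J hJ
    induction J, hJ using Set.Finite.induction_on with
    | empty => exact ⟨⊥, ⊤, map_bot p, map_top p, by simp⟩
    | @insert a J _ _ ih =>
      obtain ⟨u, v, hu, hv, h⟩ := ih
      cases ha : p a
      · refine ⟨u ⊔ a, v, by simp [hu, ha], hv, fun q hq hq' => ?_⟩
        simp only [map_sup, Bool.sup_eq_bor, Bool.or_eq_false_iff] at hq
        rintro b (rfl | hb)
        · rw [hq.2, ha]
        · exact h q hq.1 hq' b hb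
      · refine ⟨u, v ⊓ a, hu, by simp [hv, ha], fun q hq hq' => ?_⟩
        simp only [map_inf, Bool.inf_eq_band, Bool.and_eq_true] at hq'
        rintro b (rfl | hb)
        · rw [hq'.2, ha]
        · exact h q hq hq'.1 b hb
  obtain ⟨u, v, hu, hv, h⟩ := key I hI
  refine ⟨u, v, hu, hv, fun q hq hq' => hVU (htV fun a ha => ?_)⟩
  rw [h q hq hq' a ha]
  exact mem_of_mem_nhds (ht a)

end Topology

variable {L : Type u} [DistribLattice L] [BoundedOrder L]

/-- If `a ≰ b`, the prime ideal theorem gives a prime ideal containing `b` and not `a`; the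
indicator of its complement is a point violating the hypothesis. -/
theorem le_of_forall_apply {a b : L}
    (h : ∀ p : BoundedLatticeHom L Bool, p a = true → p b = true) : a ≤ b := by
  by_contra hab
  have hd : Disjoint ((Order.PFilter.principal a : Order.PFilter L) : Set L)
      (Order.Ideal.principal b : Order.Ideal L) := by
    rw [Set.disjoint_left]
    intro x hx hx'
    exact hab ((Order.PFilter.mem_principal.1 hx).trans (Order.Ideal.mem_principal.1 hx'))
  obtain ⟨J, hJ, hbJ, haJ⟩ := DistribLattice.prime_ideal_of_disjoint_filter_ideal hd
  have haJ' : a ∉ J := fun h => Set.disjoint_left.1 haJ (Order.PFilter.mem_principal.2 le_rfl) h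
  have hbJ' : b ∈ J := hbJ (Order.Ideal.mem_principal.2 le_rfl)
  classical
  let p : BoundedLatticeHom L Bool :=
    { toFun := fun x => decide (x ∉ J)
      map_sup' := fun x y => by
        rw [Bool.eq_iff_iff]
        simp [Order.Ideal.sup_mem_iff, imp_iff_not_or]
      map_inf' := fun x y => by
        rw [Bool.eq_iff_iff]
        have h1 : x ⊓ y ∈ J ↔ x ∈ J ∨ y ∈ J :=
          ⟨hJ.mem_or_mem, fun h => h.elim (J.lower inf_le_left) (J.lower inf_le_right)⟩
        simp [h1]
      map_top' := by simpa using hJ.top_notMem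
      map_bot' := by simp }
  have := h p (by simpa [p] using haJ')
  exact absurd hbJ' (by simpa [p] using this)

/-- A property of intervals which is local on the spectrum and stable under concatenation holds
for all intervals. -/
theorem interval_induction {P : L → L → Prop}
    (of_le : ∀ {u v}, v ≤ u → P u v)
    (glue : ∀ {u w v}, u ≤ w → w ≤ v → P u w → P w v → P u v)
    (loc : ∀ p : BoundedLatticeHom L Bool, ∃ u v, p u = false ∧ p v = true ∧
      ∀ u' v', u' ≤ v' → v' ≤ u' ⊔ v → v' ⊓ u ≤ u' → P u' v') {u v : L} (huv : u ≤ v) :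
    P u v := by
  -- `Q U` says that `P u v` may be deduced from the subintervals containing no point of `U`. On the
  -- whole spectrum only empty subintervals remain, and `of_le` settles those.
  let Q : Set (BoundedLatticeHom L Bool) → Prop := fun U => ∀ u v : L, u ≤ v →
    (∀ u' v', u ≤ u' → u' ≤ v' → v' ≤ v →
      (∀ p ∈ U, p v' = true → p u' = true) → P u' v') → P u v
  have hQ : Q Set.univ := by
    refine isCompact_univ.induction_on (p := Q) ?_ ?_ ?_ ?_
    · intro u v huv h
      exact h u v le_rfl huv le_rfl (by simp)
    · intro s t hst ht u v huv h
      exact ht u v huv fun u' v' h1 h2 h3 h4 => h u' v' h1 h2 h3 fun p hp => h4 p (hst hp)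
    · intro s t hs ht u v huv h
      refine hs u v huv fun u' v' h1 h2 h3 h4 => ht u' v' h2 fun u'' v'' k1 k2 k3 k4 => ?_
      refine h u'' v'' (h1.trans k1) k2 (k3.trans h3) ?_
      rintro p (hp | hp) hpv
      · exact apply_eq_true_of_le p k1 (h4 p hp (apply_eq_true_of_le p k3 hpv))
      · exact k4 p hp hpv
    · intro p _
      obtain ⟨a, b, ha, hb, hab⟩ := loc p
      refine ⟨{q | q a = false} ∩ {q | q b = true}, mem_nhdsWithin_of_mem_nhds
        (((isOpen_setOf_apply_eq a _).inter (isOpen_setOf_apply_eq b _)).mem_nhds ⟨ha, hb⟩), ?_⟩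
      intro u v huv h
      -- Cut `[u, v]` into three pieces: the middle one lies inside the neighbourhood given by `a`
      -- and `b`, where `P` is known, and the outer two miss it.
      have h1 : u ≤ v ⊓ (u ⊔ a) := le_inf huv le_sup_left
      have h2 : v ⊓ (u ⊔ a) ≤ v ⊓ (u ⊔ a ⊔ b) := inf_le_inf_left _ le_sup_left
      refine glue (h1.trans h2) inf_le_left (glue h1 h2 ?_ (hab _ _ h2 ?_ ?_)) ?_
      · refine h _ _ le_rfl h1 inf_le_left ?_
        rintro q ⟨hq, -⟩
        simp_all
      · rw [inf_sup_left v (u ⊔ a) b]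
        exact sup_le_sup_left inf_le_right _
      · exact le_inf (inf_le_left.trans inf_le_left) (inf_le_right.trans le_sup_right)
      · refine h _ _ (h1.trans h2) inf_le_left le_rfl ?_
        rintro q ⟨-, hq⟩
        simp_all
  refine hQ u v huv fun u' v' _ _ _ h => of_le (le_of_forall_apply fun p => h p trivial)

end BoundedLatticeHom

/-! ### Stalks -/

namespace SkewLattice

section Stalk

variable {S : Type u} [SkewLattice S] [IsRightDistributive S]

/-- The points of the spectrum of `S/𝒟`. -/
abbrev Point (S : Type u) [SkewLattice S] [IsRightDistributive S] : Type u :=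
  BoundedLatticeHom (LatRefl S) Bool

theorem AgreeOn.sup_inf {u v u' v' : LatRefl S} {x y : S} (h : AgreeOn u v x y) :
    AgreeOn (u ⊔ u') (v ⊓ v') x y :=
  h.mono (inf_le_left.trans le_sup_right) (inf_le_right.trans le_sup_left)

/-- Elements with the same germ at `p`. -/
def stalkSetoid (p : Point S) : Setoid S where
  r x y := ∃ u v, p u = false ∧ p v = true ∧ AgreeOn u v x y
  iseqv :=
    { refl := fun x => ⟨⊥, ⊤, map_bot p, map_top p, .refl _ _ x⟩
      symm := fun ⟨u, v, hu, hv, h⟩ => ⟨u, v, hu, hv, h.symm⟩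
      trans := fun ⟨u, v, hu, hv, h⟩ ⟨u', v', hu', hv', h'⟩ =>
        ⟨u ⊔ u', v ⊓ v', by simp [hu, hu'], by simp [hv, hv'], h.sup_inf.trans
          (by rw [sup_comm, inf_comm]; exact h'.sup_inf)⟩ }

/-- The stalk at `p`. -/
def Stalk (p : Point S) : Type u := Quotient (stalkSetoid p)

/-- The germ of `x` at `p`. -/
def germ (p : Point S) (x : S) : Stalk p := Quotient.mk _ x

theorem germ_surjective (p : Point S) : Function.Surjective (germ p) := Quotient.mk_surjective

theorem germ_eq_iff {p : Point S} {x y : S} :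
    germ p x = germ p y ↔ ∃ u v, p u = false ∧ p v = true ∧ AgreeOn u v x y :=
  Quotient.eq (r := stalkSetoid p)

instance (p : Point S) : SkewLattice (Stalk p) where
  meet := Quotient.map₂ meet fun _ _ h1 _ _ h2 => by
    obtain ⟨u, v, hu, hv, h1⟩ := h1
    exact (stalkSetoid p).trans ⟨u, v, hu, hv, h1.meet_right _⟩
      (h2.imp fun u => .imp fun v h => ⟨h.1, h.2.1, h.2.2.meet_left _⟩)
  join := Quotient.map₂ join fun _ _ h1 _ _ h2 => by
    obtain ⟨u, v, hu, hv, h1⟩ := h1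
    exact (stalkSetoid p).trans ⟨u, v, hu, hv, h1.join_right _⟩
      (h2.imp fun u => .imp fun v h => ⟨h.1, h.2.1, h.2.2.join_left _⟩)
  meet_band :=
    { assoc := by
        rintro ⟨x⟩ ⟨y⟩ ⟨z⟩
        exact congrArg (germ p) (meet_assoc x y z)
      idem := by
        rintro ⟨x⟩
        exact congrArg (germ p) (meet_idem x) }
  join_band :=
    { assoc := by
        rintro ⟨x⟩ ⟨y⟩ ⟨z⟩
        exact congrArg (germ p) (join_assoc x y z)
      idem := by
        rintro ⟨x⟩
        exact congrArg (germ p) (join_idem x) }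
  join_absorb_left := by
    rintro ⟨x⟩ ⟨y⟩
    exact congrArg (germ p) (join_absorb_left x y)
  meet_absorb_right := by
    rintro ⟨x⟩ ⟨y⟩
    exact congrArg (germ p) (meet_absorb_right x y)
  join_absorb_right := by
    rintro ⟨x⟩ ⟨y⟩
    exact congrArg (germ p) (join_absorb_right x y)
  meet_absorb_left := by
    rintro ⟨x⟩ ⟨y⟩
    exact congrArg (germ p) (meet_absorb_left x y)

theorem germ_meet (p : Point S) (x y : S) : germ p (x ⋏ y) = germ p x ⋏ germ p y := rfl

theorem germ_join (p : Point S) (x y : S) : germ p (x ⋎ y) = germ p x ⋎ germ p y := rfl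

namespace Stalk

variable {p : Point S}

/-- Whether a germ is nonzero. -/
noncomputable def supp : Stalk p → Bool := Quotient.lift (fun x => p (LatRefl.mk x)) fun x y h => by
  obtain ⟨u, v, hu, hv, h⟩ := h
  have := congrArg p h.sup_mk_eq
  rw [map_sup, map_sup, map_inf, map_inf, hu, hv] at this
  simpa using this

@[simp] theorem supp_germ (x : S) : supp (germ p x) = p (LatRefl.mk x) := rfl

/-- Both representatives are absorbed once the lower end of the interval is raised to the join of
their classes, which `p` still sends to `false`. -/
theorem eq_of_supp_eq_false {a b : Stalk p} (ha : supp a = false) (hb : supp b = false) :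
    a = b := by
  obtain ⟨x, rfl⟩ := germ_surjective p a
  obtain ⟨y, rfl⟩ := germ_surjective p b
  rw [supp_germ] at ha hb
  refine germ_eq_iff.2 ⟨LatRefl.mk x ⊔ LatRefl.mk y, ⊤, by simp [ha, hb], map_top p, ?_⟩
  rintro c d hc -
  rw [mk_le_iff_join.1 (inf_le_right.trans (le_sup_left.trans_eq hc.symm) :
      LatRefl.mk d ⊓ LatRefl.mk x ≤ _),
    mk_le_iff_join.1 (inf_le_right.trans (le_sup_right.trans_eq hc.symm) :
      LatRefl.mk d ⊓ LatRefl.mk y ≤ _)]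

/-- If `p` lies in the support of `x`, the interval may be cut down to end at `x`, and there `x ⋏ (x
⋏ y) = x ⋏ y`. -/
theorem meet_eq_ite (a b : Stalk p) : a ⋏ b = if supp a then b else a := by
  obtain ⟨x, rfl⟩ := germ_surjective p a
  obtain ⟨y, rfl⟩ := germ_surjective p b
  rw [← germ_meet]
  split_ifs with h
  · obtain ⟨z, hz⟩ := LatRefl.mk_surjective (⊥ : LatRefl S)
    refine germ_eq_iff.2 ⟨⊥, LatRefl.mk x, map_bot p, h, ?_⟩
    refine AgreeOn.of_exists (a := z) (b := x) ?_ le_sup_right (by rw [hz]; exact inf_le_right)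
    rw [← meet_assoc, meet_idem]
  · refine eq_of_supp_eq_false ?_ (by simpa using h)
    rw [supp_germ, LatRefl.mk_meet, map_inf]
    simp_all

theorem join_eq_ite (a b : Stalk p) : a ⋎ b = if supp a then a else b := by
  split_ifs with h
  · have := meet_absorb_right a b
    rwa [meet_eq_ite, if_pos h] at this
  · cases hb : supp b
    · refine eq_of_supp_eq_false ?_ hb
      obtain ⟨x, rfl⟩ := germ_surjective p a
      obtain ⟨y, rfl⟩ := germ_surjective p b
      rw [← germ_join, supp_germ, LatRefl.mk_join, map_sup]
      simp_all
    · have := meet_absorb_left b a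
      rw [meet_eq_ite] at this
      obtain ⟨x, rfl⟩ := germ_surjective p a
      obtain ⟨y, rfl⟩ := germ_surjective p b
      refine germ_eq_iff.2 ⟨LatRefl.mk x, ⊤, by simpa using h, map_top p, ?_⟩
      obtain ⟨z, hz⟩ := LatRefl.mk_surjective (⊤ : LatRefl S)
      refine AgreeOn.of_exists (a := x) (b := z) ?_ (by rw [hz]; exact le_sup_right) inf_le_right
      have hz := isGlobalElem_iff.2 hz
      rw [meet_of_isGlobalElem hz, meet_of_isGlobalElem hz, ← join_assoc, join_idem]

@[simp] theorem supp_meet (a b : Stalk p) : supp (a ⋏ b) = (supp a && supp b) := by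
  rw [meet_eq_ite]; cases h : supp a <;> simp [h]

@[simp] theorem supp_join (a b : Stalk p) : supp (a ⋎ b) = (supp a || supp b) := by
  rw [join_eq_ite]; cases h : supp a <;> simp [h]

end Stalk

end Stalk

end SkewLattice

/-! ### Locally constant sections of the stalks -/

open SkewLattice Topology

/-- The Boolean envelope of a right distributive skew lattice: the locally constant sections of
the family of stalks. -/
def BooleanEnvelope (S : Type u) [SkewLattice S] [IsRightDistributive S] : Type u :=
  {f : ∀ p : Point S, Stalk p // ∀ p, ∃ x : S, ∀ᶠ q in 𝓝 p, f q = germ q x}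

namespace BooleanEnvelope

variable {S : Type u} [SkewLattice S] [IsRightDistributive S]

instance : CoeFun (BooleanEnvelope S) fun _ => ∀ p : Point S, Stalk p := ⟨Subtype.val⟩

theorem ext {f g : BooleanEnvelope S} (h : ∀ p, f p = g p) : f = g := Subtype.ext (funext h)

/-- An element of `S` as a section. -/
def of (x : S) : BooleanEnvelope S := ⟨fun p => germ p x, fun _ => ⟨x, .of_forall fun _ => rfl⟩⟩

@[simp] theorem of_apply (x : S) (p : Point S) : of x p = germ p x := rfl

instance : SkewLattice (BooleanEnvelope S) where
  meet f g := ⟨fun p => f p ⋏ g p, fun p => by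
    obtain ⟨x, hx⟩ := f.2 p
    obtain ⟨y, hy⟩ := g.2 p
    refine ⟨x ⋏ y, ?_⟩
    filter_upwards [hx, hy] with q h1 h2
    rw [h1, h2, germ_meet]⟩
  join f g := ⟨fun p => f p ⋎ g p, fun p => by
    obtain ⟨x, hx⟩ := f.2 p
    obtain ⟨y, hy⟩ := g.2 p
    refine ⟨x ⋎ y, ?_⟩
    filter_upwards [hx, hy] with q h1 h2
    rw [h1, h2, germ_join]⟩
  meet_band := ⟨fun _ _ _ => ext fun _ => meet_assoc _ _ _, fun _ => ext fun _ => meet_idem _⟩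
  join_band := ⟨fun _ _ _ => ext fun _ => join_assoc _ _ _, fun _ => ext fun _ => join_idem _⟩
  join_absorb_left _ _ := ext fun _ => join_absorb_left _ _
  meet_absorb_right _ _ := ext fun _ => meet_absorb_right _ _
  join_absorb_right _ _ := ext fun _ => join_absorb_right _ _
  meet_absorb_left _ _ := ext fun _ => meet_absorb_left _ _

@[simp] theorem meet_apply (f g : BooleanEnvelope S) (p : Point S) : (f ⋏ g) p = f p ⋏ g p := rfl

@[simp] theorem join_apply (f g : BooleanEnvelope S) (p : Point S) : (f ⋎ g) p = f p ⋎ g p := rfl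

theorem isZeroElem_of {z : S} (hz : IsZeroElem z) : IsZeroElem (of z) := fun f =>
  ⟨ext fun p => by
      have : p (LatRefl.mk z) = false := by rw [isZeroElem_iff.1 hz]; exact map_bot p
      simp [Stalk.meet_eq_ite, this],
    ext fun p => by
      have : p (LatRefl.mk z) = false := by rw [isZeroElem_iff.1 hz]; exact map_bot p
      cases h : (f p).supp
      · simpa [Stalk.meet_eq_ite, h] using
          Stalk.eq_of_supp_eq_false h (b := germ p z) (by simpa using this)
      · simp [Stalk.meet_eq_ite, h]⟩

theorem isGlobalElem_of {g : S} (hg : IsGlobalElem g) : IsGlobalElem (of g) := by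
  intro a
  obtain ⟨f, rfl⟩ := LatRefl.mk_surjective a
  rw [← inf_eq_right, ← LatRefl.mk_meet]
  congr 1
  refine ext fun p => ?_
  have : p (LatRefl.mk g) = true := by rw [isGlobalElem_iff.1 hg]; exact map_top p
  simp [Stalk.meet_eq_ite, this]

/-- Identities pass from `S` to its quotients, the stalks, and hence to sections. Symmetry is not an
identity, so it is read off from the explicit operations on stalks. -/
instance : IsRightDistributive (BooleanEnvelope S) where
  rightRegular f g := ext fun p => by
    obtain ⟨x, hx⟩ := germ_surjective p (f p)
    obtain ⟨y, hy⟩ := germ_surjective p (g p)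
    simp only [meet_apply, ← hx, ← hy, ← germ_meet, meet_assoc, meet_right_regular]
  normal f g h := ext fun p => by
    obtain ⟨x, hx⟩ := germ_surjective p (f p)
    obtain ⟨y, hy⟩ := germ_surjective p (g p)
    obtain ⟨z, hz⟩ := germ_surjective p (h p)
    simp only [meet_apply, ← hx, ← hy, ← hz, ← germ_meet, IsRightDistributive.normal x y z]
  symmetric f g := by
    have key : ∀ p, f p ⋏ g p = g p ⋏ f p ↔ f p ⋎ g p = g p ⋎ f p := fun p => by
      simp only [Stalk.meet_eq_ite, Stalk.join_eq_ite]
      cases h : (f p).supp <;> cases h' : (g p).supp <;> simp [eq_comm]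
    exact ⟨fun h => ext fun p => (key p).1 (congrFun (congrArg Subtype.val h) p),
      fun h => ext fun p => (key p).2 (congrFun (congrArg Subtype.val h) p)⟩
  exists_zero := (IsRightDistributive.exists_zero (S := S)).imp' of fun _ => isZeroElem_of
  exists_top := by
    obtain ⟨g, hg⟩ := LatRefl.mk_surjective (⊤ : LatRefl S)
    exact ⟨_, isGlobalElem_of (isGlobalElem_iff.2 hg)⟩
  distrib := by
    rintro ⟨f⟩ ⟨g⟩ ⟨h⟩
    refine congrArg LatRefl.mk (?_ : f ⋏ (g ⋎ h) = (f ⋏ g) ⋎ (f ⋏ h))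
    refine ext fun p => ?_
    obtain ⟨x, hx⟩ := germ_surjective p (f p)
    obtain ⟨y, hy⟩ := germ_surjective p (g p)
    obtain ⟨z, hz⟩ := germ_surjective p (h p)
    simp only [meet_apply, join_apply, ← hx, ← hy, ← hz, ← germ_meet, ← germ_join, meet_join]

/-- This identifies the `𝒟`-class of a section with its support. -/
theorem mk_le_mk_iff {f g : BooleanEnvelope S} :
    LatRefl.mk f ≤ LatRefl.mk g ↔ ∀ p, (f p).supp = true → (g p).supp = true := by
  rw [mk_le_iff]
  constructor
  · intro h p hp
    rw [← h, meet_apply, Stalk.supp_meet, Bool.and_eq_true] at hp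
    exact hp.1
  · intro h
    refine ext fun p => ?_
    rw [meet_apply, Stalk.meet_eq_ite]
    split_ifs with hg
    · rfl
    · refine Stalk.eq_of_supp_eq_false (by simpa using hg) ?_
      by_contra hf
      exact hg (h p (by simpa using hf))

theorem mk_eq_mk_iff {f g : BooleanEnvelope S} :
    LatRefl.mk f = LatRefl.mk g ↔ ∀ p, (f p).supp = (g p).supp := by
  rw [le_antisymm_iff, mk_le_mk_iff, mk_le_mk_iff, ← forall_and]
  exact forall_congr' fun p => iff_iff_implies_and_implies.symm.trans Bool.eq_iff_iff.symm

theorem eventually_apply_eq (p : Point S) (a : LatRefl S) : ∀ᶠ q in 𝓝 p, q a = p a :=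
  (BoundedLatticeHom.isOpen_setOf_apply_eq a (p a)).mem_nhds rfl

instance : ComplementedLattice (LatRefl (BooleanEnvelope S)) where
  exists_isCompl a := by
    obtain ⟨f, rfl⟩ := LatRefl.mk_surjective a
    obtain ⟨z, hz⟩ := LatRefl.mk_surjective (⊥ : LatRefl S)
    obtain ⟨t, ht⟩ := LatRefl.mk_surjective (⊤ : LatRefl S)
    have hz' := isZeroElem_iff.1 (isZeroElem_of (isZeroElem_iff.2 hz))
    have ht' := isGlobalElem_iff.1 (isGlobalElem_of (isGlobalElem_iff.2 ht))
    -- The complement takes a global value where `f` vanishes and the zero value elsewhere; it is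
    -- locally constant because the support of `f` is clopen.
    let g : BooleanEnvelope S := ⟨fun p => germ p (if (f p).supp then z else t), fun p => by
      obtain ⟨x, hx⟩ := f.2 p
      refine ⟨if (f p).supp then z else t, ?_⟩
      filter_upwards [hx, eventually_apply_eq p (LatRefl.mk x)] with q h1 h2
      rw [h1, hx.self_of_nhds, Stalk.supp_germ, Stalk.supp_germ, h2]⟩
    have hg : ∀ p, (g p).supp = !(f p).supp := fun p => by
      change (germ p (if (f p).supp then z else t)).supp = _
      cases h : (f p).supp
      · simp only [Bool.false_eq_true, if_false, Stalk.supp_germ, ht]; exact map_top p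
      · simp only [if_true, Stalk.supp_germ, hz]; exact map_bot p
    refine ⟨LatRefl.mk g, isCompl_iff.2 ⟨disjoint_iff_inf_le.2 ?_, codisjoint_iff_le_sup.2 ?_⟩⟩
    · rw [← hz', ← LatRefl.mk_meet, mk_le_mk_iff]
      intro p
      simp [hg]
    · rw [← ht', ← LatRefl.mk_join, mk_le_mk_iff]
      intro p
      simp [hg]

theorem exists_interval (f : BooleanEnvelope S) (p : Point S) :
    ∃ (x : S) (u v : LatRefl S), p u = false ∧ p v = true ∧
      ∀ q : Point S, q u = false → q v = true → f q = germ q x := by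
  obtain ⟨x, hx⟩ := f.2 p
  exact ⟨x, BoundedLatticeHom.exists_interval_of_mem_nhds hx⟩

/-- Equal germs give agreement on an interval around each point; these agreements glue to agreement
on `[⊥, ⊤]`, which is equality. -/
theorem of_injective : Function.Injective (of : S → BooleanEnvelope S) := by
  intro x y h
  apply AgreeOn.eq
  refine BoundedLatticeHom.interval_induction (P := fun u v => AgreeOn u v x y)
    AgreeOn.of_le (fun h1 h2 h3 h4 => h3.glue h4 h1 h2) (fun p => ?_) bot_le
  obtain ⟨u, v, hu, hv, huv⟩ := germ_eq_iff.1 (congrFun (congrArg Subtype.val h) p)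
  exact ⟨u, v, hu, hv, fun u' v' _ h1 h2 => huv.mono h1 h2⟩

theorem mk_of_eq_mk_of_iff {x y : S} :
    LatRefl.mk (of x) = LatRefl.mk (of y) ↔ LatRefl.mk x = LatRefl.mk y := by
  rw [mk_eq_mk_iff]
  constructor
  · intro h
    exact le_antisymm (BoundedLatticeHom.le_of_forall_apply fun p hp => (h p).symm.trans hp)
      (BoundedLatticeHom.le_of_forall_apply fun p hp => (h p).trans hp)
  · intro h p
    rw [of_apply, of_apply, Stalk.supp_germ, Stalk.supp_germ, h]

/-- The intervals `u ≤ v` contained, as clopen sets, in that of `a ≤ b`. -/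
theorem apply_of_interval_le {a b u v : LatRefl S} (hb : v ≤ u ⊔ b) (ha : v ⊓ a ≤ u)
    {q : Point S} (hu : q u = false) (hv : q v = true) : q a = false ∧ q b = true := by
  constructor
  · by_contra h
    have := q.apply_eq_true_of_le ha (by rw [map_inf, hv]; simpa using h)
    simp_all
  · have := q.apply_eq_true_of_le hb hv
    rw [map_sup, hu] at this
    simpa using this

theorem exists_eq_of {f : BooleanEnvelope S} {a : S} (h : LatRefl.mk f = LatRefl.mk (of a)) :
    ∃ x, of x = f := by
  rw [mk_eq_mk_iff] at h
  -- The trivial premise is there so that the induction carries `v ≤ LatRefl.mk a`, which keeps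
  -- every interval inside the support of `f`.
  have key : LatRefl.mk a ≤ LatRefl.mk a →
      ∃ x, ∀ q : Point S, q ⊥ = false → q (LatRefl.mk a) = true → f q = germ q x := by
    refine BoundedLatticeHom.interval_induction (P := fun u v => v ≤ LatRefl.mk a →
      ∃ x, ∀ q : Point S, q u = false → q v = true → f q = germ q x) ?_ ?_ ?_ bot_le
    · intro u v huv _
      refine ⟨a, fun q hu hv => ?_⟩
      have := q.apply_eq_true_of_le huv hv
      simp_all
    · intro u w v _ hwv h1 h2 hva
      obtain ⟨x, hx⟩ := h1 (hwv.trans hva)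
      obtain ⟨y, hy⟩ := h2 hva
      obtain ⟨c, rfl⟩ := LatRefl.mk_surjective w
      -- Where `c` is true, `x` agrees with `f` and so is in the support, and the join selects it
      -- over `y`; where `c` is false, `c ⋏ x` vanishes and `y` remains.
      refine ⟨(c ⋏ x) ⋎ y, fun q hu hv => ?_⟩
      have hq := (h q).trans (q.apply_eq_true_of_le hva hv)
      rw [germ_join, germ_meet, Stalk.join_eq_ite, Stalk.meet_eq_ite, Stalk.supp_germ]
      cases hc : q (LatRefl.mk c)
      · simpa [hc] using hy q hc hv
      · have hx' := hx q hu hc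
        rw [hx', Stalk.supp_germ] at hq
        simpa [hq] using hx'
    · intro p
      obtain ⟨x, u, v, hu, hv, hx⟩ := f.exists_interval p
      refine ⟨u, v, hu, hv, fun u' v' _ h1 h2 _ => ⟨x, fun q hu' hv' => ?_⟩⟩
      obtain ⟨h3, h4⟩ := apply_of_interval_le h1 h2 hu' hv'
      exact hx q h3 h4
  obtain ⟨x, hx⟩ := key le_rfl
  -- Meeting with `a` makes the section vanish outside the support of `f`.
  refine ⟨a ⋏ x, ext fun q => ?_⟩
  rw [of_apply, germ_meet, Stalk.meet_eq_ite]
  split_ifs with hq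
  · exact (hx q (map_bot q) hq).symm
  · rw [Stalk.supp_germ] at hq
    exact Stalk.eq_of_supp_eq_false (by simpa using hq) ((h q).trans (by simpa using hq))

theorem of_surjective [ComplementedLattice (LatRefl S)] :
    Function.Surjective (of : S → BooleanEnvelope S) := by
  intro f
  have key : ∃ x, ∀ q : Point S, q ⊥ = false → q ⊤ = true → f q = germ q x := by
    refine BoundedLatticeHom.interval_induction (P := fun u v =>
      ∃ x, ∀ q : Point S, q u = false → q v = true → f q = germ q x) ?_ ?_ ?_ bot_le
    · intro u v huv
      refine ⟨(IsRightDistributive.exists_zero (S := S)).choose, fun q hu hv => ?_⟩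
      have := q.apply_eq_true_of_le huv hv
      simp_all
    · rintro u w v _ _ ⟨x, hx⟩ ⟨y, hy⟩
      obtain ⟨w', hw⟩ := exists_isCompl w
      obtain ⟨c, rfl⟩ := LatRefl.mk_surjective w
      obtain ⟨d, rfl⟩ := LatRefl.mk_surjective w'
      -- Here `f` may vanish where `c` is true, and a bare `y` would show through there; the
      -- complement `d` of `c` cuts it off.
      refine ⟨(c ⋏ x) ⋎ (d ⋏ y), fun q hu hv => ?_⟩
      have h1 : (q (LatRefl.mk c) && q (LatRefl.mk d)) = false := by
        have h := congrArg q hw.inf_eq_bot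
        rwa [map_inf, map_bot] at h
      have h2 : (q (LatRefl.mk c) || q (LatRefl.mk d)) = true := by
        have h := congrArg q hw.sup_eq_top
        rwa [map_sup, map_top] at h
      rw [germ_join, germ_meet, germ_meet, Stalk.join_eq_ite, Stalk.meet_eq_ite,
        Stalk.meet_eq_ite, Stalk.supp_germ, Stalk.supp_germ]
      cases hc : q (LatRefl.mk c)
      · simpa [hc, (by simpa [hc] using h2 : q (LatRefl.mk d) = true)] using hy q hc hv
      · have hd : q (LatRefl.mk d) = false := by simpa [hc] using h1
        rw [hx q hu hc]
        simp only [if_true, Stalk.supp_germ, hd, Bool.false_eq_true, if_false]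
        split_ifs with h
        · rfl
        · exact Stalk.eq_of_supp_eq_false (by simpa using h) hd
    · intro p
      obtain ⟨x, u, v, hu, hv, hx⟩ := f.exists_interval p
      refine ⟨u, v, hu, hv, fun u' v' _ h1 h2 => ⟨x, fun q hu' hv' => ?_⟩⟩
      obtain ⟨h3, h4⟩ := apply_of_interval_le h1 h2 hu' hv'
      exact hx q h3 h4
  obtain ⟨x, hx⟩ := key
  exact ⟨x, ext fun q => (hx q (map_bot q) (map_top q)).symm⟩

end BooleanEnvelope

/-! ### The reflection -/

theorem IsZeroElem.eq {S : Type u} [SkewLattice S] {x y : S} (hx : IsZeroElem x)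
    (hy : IsZeroElem y) : x = y := (hx y).1.symm.trans (hy x).2

/-- Written as equations, globality can be checked after applying an injective morphism or a jointly
injective pair. -/
theorem isGlobalElem_iff_forall {S : Type u} [SkewLattice S] [IsRightDistributive S] {g : S} :
    IsGlobalElem g ↔ ∀ x, g ⋏ x = x :=
  ⟨meet_of_isGlobalElem, fun h a => by
    obtain ⟨x, rfl⟩ := LatRefl.mk_surjective a
    exact mk_le_iff.2 (h x)⟩

namespace RightDistSkewLat

variable {S T U : RightDistSkewLat.{u}}

theorem fn_meet (φ : S ⟶ T) (x y : S) : fn φ (x ⋏ y) = fn φ x ⋏ fn φ y := Hom.map_meet φ x y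

theorem fn_join (φ : S ⟶ T) (x y : S) : fn φ (x ⋎ y) = fn φ x ⋎ fn φ y := Hom.map_join φ x y

/-- The inverse of a bijective morphism. -/
noncomputable def invOfBijective (φ : S ⟶ T) (h : Function.Bijective (fn φ)) : T ⟶ S :=
  let e := Equiv.ofBijective (fn φ) h
  have he : ∀ y, fn φ (e.symm y) = y := e.apply_symm_apply
  { toFun := e.symm
    map_meet := fun x y => h.1 (by rw [fn_meet, he, he, he])
    map_join := fun x y => h.1 (by rw [fn_join, he, he, he])
    map_zero := fun z hz x => ⟨h.1 (by rw [fn_meet, he, (hz _).1]),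
      h.1 (by rw [fn_meet, he, (hz _).2])⟩
    map_global := fun g hg => isGlobalElem_iff_forall.2 fun x =>
      h.1 (by rw [fn_meet, he, isGlobalElem_iff_forall.1 hg]) }

theorem comp_invOfBijective (φ : S ⟶ T) (h : Function.Bijective (fn φ)) :
    φ ≫ invOfBijective φ h = 𝟙 S :=
  fn_injective (funext fun x => (Equiv.ofBijective (fn φ) h).symm_apply_apply x)

/-! ### Functoriality of the envelope -/

/-- The map of spectra induced by a morphism. -/
noncomputable def comapPoint (φ : S ⟶ T) (p : Point T) : Point S := p.comp (latReflHom φ)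

theorem comapPoint_comp (φ : S ⟶ T) (ψ : T ⟶ U) (p : Point U) :
    comapPoint (φ ≫ ψ) p = comapPoint φ (comapPoint ψ p) := by
  refine DFunLike.ext _ _ fun a => ?_
  obtain ⟨x, rfl⟩ := LatRefl.mk_surjective a
  rfl

theorem continuous_comapPoint (φ : S ⟶ T) : Continuous (comapPoint φ) :=
  continuous_induced_rng.2 (continuous_pi fun a =>
    BoundedLatticeHom.continuous_eval (latReflHom φ a))

/-- The map of stalks induced by a morphism. -/
noncomputable def stalkMap (φ : S ⟶ T) (p : Point T) : Stalk (comapPoint φ p) → Stalk p :=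
  Quotient.map (fn φ) fun x y => by
    rintro ⟨u, v, hu, hv, h⟩
    obtain ⟨a, rfl⟩ := LatRefl.mk_surjective u
    obtain ⟨b, rfl⟩ := LatRefl.mk_surjective v
    -- The image of `φ` need not contain all representatives of these two classes, so agreement is
    -- obtained from a single pair.
    refine ⟨LatRefl.mk (fn φ a), LatRefl.mk (fn φ b), hu, hv,
      AgreeOn.of_exists (a := fn φ a) (b := fn φ b) ?_ le_sup_right inf_le_right⟩
    rw [← fn_meet, ← fn_meet, ← fn_join, ← fn_join, h a b rfl rfl]

theorem stalkMap_germ (φ : S ⟶ T) (p : Point T) (x : S) :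
    stalkMap φ p (germ _ x) = germ p (fn φ x) := rfl

theorem supp_stalkMap (φ : S ⟶ T) (p : Point T) (a : Stalk (comapPoint φ p)) :
    (stalkMap φ p a).supp = a.supp := by
  obtain ⟨x, rfl⟩ := germ_surjective _ a
  rfl

theorem stalkMap_meet (φ : S ⟶ T) (p : Point T) (a b : Stalk (comapPoint φ p)) :
    stalkMap φ p (a ⋏ b) = stalkMap φ p a ⋏ stalkMap φ p b := by
  simp only [Stalk.meet_eq_ite, supp_stalkMap, apply_ite (stalkMap φ p)]

theorem stalkMap_join (φ : S ⟶ T) (p : Point T) (a b : Stalk (comapPoint φ p)) :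
    stalkMap φ p (a ⋎ b) = stalkMap φ p a ⋎ stalkMap φ p b := by
  simp only [Stalk.join_eq_ite, supp_stalkMap, apply_ite (stalkMap φ p)]

/-- The Boolean envelope as an object of the category. -/
def env (S : RightDistSkewLat.{u}) : RightDistSkewLat.{u} where
  carrier := BooleanEnvelope S

theorem isBoolean_env (S : RightDistSkewLat.{u}) : isBoolean (env S) :=
  inferInstanceAs (ComplementedLattice (LatRefl (BooleanEnvelope S)))

/-- The embedding into the Boolean envelope. -/
def toEnv (S : RightDistSkewLat.{u}) : S ⟶ env S where
  toFun := BooleanEnvelope.of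
  map_meet _ _ := rfl
  map_join _ _ := rfl
  map_zero _ := BooleanEnvelope.isZeroElem_of
  map_global _ := BooleanEnvelope.isGlobalElem_of

/-- The action of a morphism on sections. -/
noncomputable def mapSection (φ : S ⟶ T) (f : BooleanEnvelope S) : BooleanEnvelope T :=
  ⟨fun p => stalkMap φ p (f (comapPoint φ p)), fun p => by
    obtain ⟨x, hx⟩ := f.2 (comapPoint φ p)
    refine ⟨fn φ x, ?_⟩
    filter_upwards [(continuous_comapPoint φ).continuousAt.eventually hx] with q hq
    rw [hq, stalkMap_germ]⟩

theorem mapSection_apply (φ : S ⟶ T) (f : BooleanEnvelope S) (p : Point T) :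
    mapSection φ f p = stalkMap φ p (f (comapPoint φ p)) := rfl

theorem mapSection_of (φ : S ⟶ T) (x : S) :
    mapSection φ (BooleanEnvelope.of x) = BooleanEnvelope.of (fn φ x) := rfl

/-- Keeping the point `q` and the equation `hq` as variables avoids transport between stalks at
points that are only propositionally equal. -/
theorem mapSection_apply_eq_germ (φ : S ⟶ T) {f : BooleanEnvelope S} {q : Point S} {p : Point T}
    {x : S} (hq : comapPoint φ p = q) (hx : f q = germ q x) :
    mapSection φ f p = germ p (fn φ x) := by
  subst hq
  rw [mapSection_apply, hx, stalkMap_germ]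

/-- Sections with equal supports have images with equal supports, so `f` may be replaced by the
section of a global element of `S`. -/
theorem isGlobalElem_mapSection (φ : S ⟶ T) {f : BooleanEnvelope S} (hf : IsGlobalElem f) :
    IsGlobalElem (mapSection φ f) := by
  obtain ⟨t, ht⟩ := LatRefl.mk_surjective (⊤ : LatRefl S)
  have ht := isGlobalElem_iff.2 ht
  have h := (isGlobalElem_iff.1 hf).trans
    (isGlobalElem_iff.1 (BooleanEnvelope.isGlobalElem_of ht)).symm
  have h' : LatRefl.mk (mapSection φ f) = LatRefl.mk (mapSection φ (BooleanEnvelope.of t)) := by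
    rw [BooleanEnvelope.mk_eq_mk_iff] at h ⊢
    intro p
    rw [mapSection_apply, mapSection_apply, supp_stalkMap, supp_stalkMap, h]
  rw [isGlobalElem_iff, h', ← isGlobalElem_iff]
  exact BooleanEnvelope.isGlobalElem_of (Hom.map_global φ t ht)

theorem isZeroElem_mapSection (φ : S ⟶ T) {f : BooleanEnvelope S} (hf : IsZeroElem f) :
    IsZeroElem (mapSection φ f) := by
  obtain ⟨z, hz⟩ := IsRightDistributive.exists_zero (S := S)
  rw [hf.eq (BooleanEnvelope.isZeroElem_of hz), mapSection_of]
  exact BooleanEnvelope.isZeroElem_of (Hom.map_zero φ z hz)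

/-- Functoriality of the Boolean envelope. -/
noncomputable def envMap (φ : S ⟶ T) : env S ⟶ env T where
  toFun := mapSection φ
  map_meet _ _ := BooleanEnvelope.ext fun p => stalkMap_meet φ p _ _
  map_join _ _ := BooleanEnvelope.ext fun p => stalkMap_join φ p _ _
  map_zero _ := isZeroElem_mapSection φ
  map_global _ := isGlobalElem_mapSection φ

theorem toEnv_comp_envMap (φ : S ⟶ T) : toEnv S ≫ envMap φ = φ ≫ toEnv T := rfl

theorem envMap_comp (φ : S ⟶ T) (ψ : T ⟶ U) : envMap (φ ≫ ψ) = envMap φ ≫ envMap ψ := by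
  refine fn_injective (funext fun (f : BooleanEnvelope S) => BooleanEnvelope.ext fun p => ?_)
  obtain ⟨x, hx⟩ := germ_surjective _ (f (comapPoint φ (comapPoint ψ p)))
  exact (mapSection_apply_eq_germ (φ ≫ ψ) (comapPoint_comp φ ψ p) hx.symm).trans
    (mapSection_apply_eq_germ ψ rfl (mapSection_apply_eq_germ φ rfl hx.symm)).symm

/-- On an interval around the point below `p`, the section `f` equals some `of x`. That interval is
given by elements of `S`, so `f` and `of x` agree on its image in `env S` and have the same germ at
`p`. This identity yields uniqueness of extensions along `toEnv`. -/
theorem envMap_toEnv (S : RightDistSkewLat.{u}) : envMap (toEnv S) = toEnv (env S) := by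
  refine fn_injective (funext fun (f : BooleanEnvelope S) => BooleanEnvelope.ext fun p => ?_)
  obtain ⟨x, u, v, hu, hv, h⟩ := f.exists_interval (comapPoint (toEnv S) p)
  refine (mapSection_apply_eq_germ (toEnv S) rfl (h _ hu hv)).trans ?_
  obtain ⟨a, rfl⟩ := LatRefl.mk_surjective u
  obtain ⟨b, rfl⟩ := LatRefl.mk_surjective v
  refine germ_eq_iff.2 ⟨LatRefl.mk (BooleanEnvelope.of a), LatRefl.mk (BooleanEnvelope.of b),
    hu, hv, AgreeOn.of_exists (a := BooleanEnvelope.of a) (b := BooleanEnvelope.of b) ?_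
      le_sup_right inf_le_right⟩
  refine BooleanEnvelope.ext fun q => ?_
  change germ q a ⋎ (germ q b ⋏ germ q x) = germ q a ⋎ (germ q b ⋏ f q)
  simp only [Stalk.join_eq_ite, Stalk.meet_eq_ite]
  by_cases h1 : (germ q a).supp = true
  · rw [if_pos h1, if_pos h1]
  · rw [if_neg h1, if_neg h1]
    by_cases h2 : (germ q b).supp = true
    · rw [if_pos h2, if_pos h2, h q (by simpa using h1) h2]
    · rw [if_neg h2, if_neg h2]

/-! ### The adjunction -/

theorem bijective_toEnv (hS : isBoolean S) : Function.Bijective (fn (toEnv S)) :=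
  have : ComplementedLattice (LatRefl S) := hS
  ⟨BooleanEnvelope.of_injective, BooleanEnvelope.of_surjective⟩

/-- The universal property of the Boolean envelope. -/
noncomputable def envHomEquiv (S : RightDistSkewLat.{u}) (hT : isBoolean T) :
    (env S ⟶ T) ≃ (S ⟶ T) where
  toFun h := toEnv S ≫ h
  invFun g := envMap g ≫ invOfBijective (toEnv T) (bijective_toEnv hT)
  left_inv h := by
    change envMap (toEnv S ≫ h) ≫ _ = h
    rw [envMap_comp, envMap_toEnv, toEnv_comp_envMap, Category.assoc, comp_invOfBijective,
      Category.comp_id]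
  right_inv g := by
    change toEnv S ≫ envMap g ≫ _ = g
    rw [← Category.assoc, toEnv_comp_envMap, Category.assoc, comp_invOfBijective,
      Category.comp_id]

/-- `envHomEquiv`, as a bijection of morphisms in the full subcategory. -/
noncomputable def boolHomEquiv (S : RightDistSkewLat.{u}) (T : isBoolean.{u}.FullSubcategory) :
    ((⟨env S, isBoolean_env S⟩ : isBoolean.{u}.FullSubcategory) ⟶ T) ≃
      (S ⟶ isBoolean.{u}.ι.obj T) :=
  InducedCategory.homEquiv.trans (envHomEquiv S T.property)

theorem boolHomEquiv_comp (S : RightDistSkewLat.{u}) (T T' : isBoolean.{u}.FullSubcategory)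
    (g : T ⟶ T') (h : (⟨env S, isBoolean_env S⟩ : isBoolean.{u}.FullSubcategory) ⟶ T) :
    boolHomEquiv S T' (h ≫ g) = boolHomEquiv S T h ≫ isBoolean.{u}.ι.map g := rfl

/-- Right Boolean skew lattices form a reflective subcategory. -/
@[reducible] noncomputable def reflectiveIsBoolean : Reflective isBoolean.{u}.ι where
  L := Adjunction.leftAdjointOfEquiv boolHomEquiv boolHomEquiv_comp
  adj := Adjunction.adjunctionOfEquivLeft boolHomEquiv boolHomEquiv_comp

theorem reflectiveIsBoolean_unit_app (S : RightDistSkewLat.{u}) :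
    reflectiveIsBoolean.adj.unit.app S = toEnv S := by
  simp
  rfl

/-! ### The pullback square and the lattice reflection of the unit -/

/-- A square of right distributive skew lattices which is a pullback of sets is a pullback. -/
theorem isPullback_of_existsUnique {P X Y Z : RightDistSkewLat.{u}} {f : P ⟶ X} {g : P ⟶ Y}
    {h : X ⟶ Z} {k : Y ⟶ Z} (w : f ≫ h = g ≫ k)
    (H : ∀ x y, fn h x = fn k y → ∃! p, fn f p = x ∧ fn g p = y) : IsPullback f g h k := by
  -- Joint injectivity of the two projections lets every property of the mediating map be checked in
  -- `X` and `Y`.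
  have inj : ∀ {p q : P}, fn f p = fn f q → fn g p = fn g q → p = q := fun {p q} h1 h2 =>
    (H (fn f q) (fn g q) (congrFun (congrArg fn w) q)).unique ⟨h1, h2⟩ ⟨rfl, rfl⟩
  refine ⟨⟨w⟩, ⟨Limits.PullbackCone.isLimitAux' _ fun s => ?_⟩⟩
  have hs : ∀ a, fn h (fn s.fst a) = fn k (fn s.snd a) := fun a =>
    congrFun (congrArg fn s.condition) a
  let l : s.pt → P := fun a => (H _ _ (hs a)).choose
  have hl1 : ∀ a, fn f (l a) = fn s.fst a := fun a => (H _ _ (hs a)).choose_spec.1.1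
  have hl2 : ∀ a, fn g (l a) = fn s.snd a := fun a => (H _ _ (hs a)).choose_spec.1.2
  let m : s.pt ⟶ P :=
    { toFun := l
      map_meet := fun x y => inj (by rw [fn_meet, hl1, hl1, hl1, fn_meet])
        (by rw [fn_meet, hl2, hl2, hl2, fn_meet])
      map_join := fun x y => inj (by rw [fn_join, hl1, hl1, hl1, fn_join])
        (by rw [fn_join, hl2, hl2, hl2, fn_join])
      map_zero := fun z hz => by
        obtain ⟨z', hz'⟩ := IsRightDistributive.exists_zero (S := P)
        have e : l z = z' := inj
          ((hl1 z).trans ((Hom.map_zero s.fst z hz).eq (Hom.map_zero f z' hz')))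
          ((hl2 z).trans ((Hom.map_zero s.snd z hz).eq (Hom.map_zero g z' hz')))
        rw [e]
        exact hz'
      map_global := fun t ht => isGlobalElem_iff_forall.2 fun a => inj
        (by rw [fn_meet, hl1]; exact isGlobalElem_iff_forall.1 (Hom.map_global s.fst t ht) _)
        (by rw [fn_meet, hl2]; exact isGlobalElem_iff_forall.1 (Hom.map_global s.snd t ht) _) }
  exact ⟨m, fn_injective (funext hl1), fn_injective (funext hl2), fun {n} h1 h2 =>
    fn_injective (funext fun a => inj ((congrFun (congrArg fn h1) a).trans (hl1 a).symm)
      ((congrFun (congrArg fn h2) a).trans (hl2 a).symm))⟩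

/-- A morphism to a commutative skew lattice factors through the lattice reflection. -/
noncomputable def latReflDesc {C : BddDistLat.{u}} (h : S ⟶ ofBddDistLat.obj C) :
    BddDistLat.of (LatRefl S) ⟶ C :=
  let F : LatRefl S → C := Quotient.lift (fn h) fun x y hxy =>
    OfLattice.mk_injective (L := C) (congrArg (latReflMap h) (Quotient.sound hxy))
  BddDistLat.ofHom
    { toFun := F
      map_sup' := by
        rintro ⟨x⟩ ⟨y⟩
        exact fn_join h x y
      map_inf' := by
        rintro ⟨x⟩ ⟨y⟩
        exact fn_meet h x y
      map_top' := by
        obtain ⟨g, hg⟩ := LatRefl.mk_surjective (⊤ : LatRefl S)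
        rw [← hg]
        exact OfLattice.eq_top (L := C) (Hom.map_global h g (isGlobalElem_iff.2 hg))
      map_bot' := by
        obtain ⟨z, hz⟩ := LatRefl.mk_surjective (⊥ : LatRefl S)
        rw [← hz]
        exact OfLattice.eq_bot (L := C) (Hom.map_zero h z (isZeroElem_iff.2 hz)) }

theorem latticeReflection_hom_ext {C : BddDistLat.{u}} {g h : latticeReflection.obj S ⟶ C}
    (e : toLatticeReflection.app S ≫ ofBddDistLat.map g =
      toLatticeReflection.app S ≫ ofBddDistLat.map h) : g = h := by
  ext a
  obtain ⟨x, rfl⟩ := LatRefl.mk_surjective a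
  exact congrFun (congrArg fn e) x

theorem isBoolean_ofBddDistLat (C : BddDistLat.{u}) [ComplementedLattice C] :
    isBoolean (ofBddDistLat.obj C) := by
  refine (⟨fun a => ?_⟩ : ComplementedLattice (LatRefl C))
  obtain ⟨x, rfl⟩ := LatRefl.mk_surjective a
  obtain ⟨y, hy⟩ := exists_isCompl (x : C)
  refine ⟨LatRefl.mk (S := C) y, isCompl_iff.2 ⟨disjoint_iff.2 ?_, codisjoint_iff.2 ?_⟩⟩
  · refine (congrArg (LatRefl.mk (S := C)) hy.inf_eq_bot).trans ?_
    exact (OfLattice.isZeroElem_bot (L := C)).isBot_mk.eq_bot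
  · refine (congrArg (LatRefl.mk (S := C)) hy.sup_eq_top).trans ?_
    exact IsTop.eq_top (OfLattice.isGlobalElem_top (L := C))

/-- Homomorphisms from `S/𝒟` to `C` correspond to morphisms from `S` to the commutative skew lattice
`C`, and likewise for `env S`; so this is the universal property of `env S` for commutative Boolean
targets. -/
theorem isBooleanEnvelope_toEnv (S : RightDistSkewLat.{u}) :
    IsBooleanEnvelope (latticeReflection.map (toEnv S)) where
  complemented := isBoolean_env S
  existsUnique_lift C hC g := by
    have key : ∀ h : latticeReflection.obj (env S) ⟶ C, latticeReflection.map (toEnv S) ≫ h = g ↔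
        toEnv S ≫ toLatticeReflection.app (env S) ≫ ofBddDistLat.map h =
          toLatticeReflection.app S ≫ ofBddDistLat.map g := fun h => by
      have e : toEnv S ≫ toLatticeReflection.app (env S) ≫ ofBddDistLat.map h =
          toLatticeReflection.app S ≫
            ofBddDistLat.map (latticeReflection.map (toEnv S) ≫ h) := rfl
      rw [e]
      exact ⟨fun h => by rw [h], latticeReflection_hom_ext⟩
    let E := envHomEquiv S (isBoolean_ofBddDistLat C)
    refine ⟨latReflDesc (E.symm (toLatticeReflection.app S ≫ ofBddDistLat.map g)),
      (key _).2 ?_, fun h hh => latticeReflection_hom_ext (E.injective ?_)⟩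
    · exact E.apply_symm_apply _
    · exact ((key h).1 hh).trans (E.apply_symm_apply _).symm

/-- Compatibility says that the support of `b` comes from `S/𝒟`, which is the hypothesis of
`exists_eq_of`. -/
theorem existsUnique_toEnv (S : RightDistSkewLat.{u}) (b : env S) (a : LatRefl S)
    (h : LatRefl.mk b = latReflMap (toEnv S) a) :
    ∃! s : S, fn (toEnv S) s = b ∧ LatRefl.mk s = a := by
  obtain ⟨x, rfl⟩ := LatRefl.mk_surjective a
  obtain ⟨s, rfl⟩ := BooleanEnvelope.exists_eq_of (f := b) h
  exact ⟨s, ⟨rfl, BooleanEnvelope.mk_of_eq_mk_of_iff.1 h⟩, fun t ht =>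
    BooleanEnvelope.of_injective ht.1⟩

theorem isPullback_toEnv (S : RightDistSkewLat.{u}) :
    IsPullback (toEnv S) (toLatticeReflection.app S) (toLatticeReflection.app (env S))
      (ofBddDistLat.map (latticeReflection.map (toEnv S))) :=
  isPullback_of_existsUnique (toLatticeReflection.naturality (toEnv S)) (existsUnique_toEnv S)

end RightDistSkewLat

theorem mainTheorem5 :
    ∃ R : Reflective RightDistSkewLat.isBoolean.{u}.ι,
      ∀ S : RightDistSkewLat.{u},
        letI SB : RightDistSkewLat.{u} := (R.L.obj S).obj
        letI η : S ⟶ SB := R.adj.unit.app S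
        -- the reflection map is an embedding
        Function.Injective (RightDistSkewLat.fn η) ∧
        -- it lies over the Boolean envelope of `S/𝒟`
        IsBooleanEnvelope (RightDistSkewLat.latticeReflection.map η) ∧
        -- the square with the lattice reflections is a pullback of right distributive skew lattices
        IsPullback η
          (RightDistSkewLat.toLatticeReflection.app S)
          (RightDistSkewLat.toLatticeReflection.app SB)
          (RightDistSkewLat.ofBddDistLat.map (RightDistSkewLat.latticeReflection.map η)) ∧
        -- and also a pullback of underlying sets
        ∀ (b : SB) (a : LatRefl S), LatRefl.mk b = RightDistSkewLat.latReflMap η a →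
          ∃! s : S, RightDistSkewLat.fn η s = b ∧ LatRefl.mk s = a := by
  refine ⟨RightDistSkewLat.reflectiveIsBoolean, fun S => ?_⟩
  rw [RightDistSkewLat.reflectiveIsBoolean_unit_app S]
  exact ⟨BooleanEnvelope.of_injective, RightDistSkewLat.isBooleanEnvelope_toEnv S,
    RightDistSkewLat.isPullback_toEnv S, RightDistSkewLat.existsUnique_toEnv S⟩
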